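/- Let $n\ge 2$, let $N$ be a compact smooth $(n-1)$-dimensional manifold (with or without boundary), and let $M=(0,\pi)\times N$. Let $\hat G$ be a fixed smooth Riemannian metric on $N$, with Riemannian volume measure $\mu_{\hat G}$, and put $g_0=dr^2+\sin^2(r)\,\hat G$. Let $g=dr^2+G(r)$ be a smooth Riemannian metric on $M$, where $G(r)$, $r\in(0,\pi)$, is a family of Riemannian metrics on $N$. Let $R_{rr}$ be the Ricci curvature of $g$ in the direction $(\partial_r,\partial_r)$. Let $H$ and $\mathring H$ be the mean curvatures (traces of the Weingarten maps $X\mapsto\nabla_X\partial_r$) of the level sets $\{r\}\times N$ relative to $g$ and $g_0$ respectively, and put $$m(r,x)=\sin^2(r)\,\bigl(\mathring H(r,x)-H(r,x)\bigr),\qquad \mathcal M(r)=\int_N m(r,x)\,d\mu_{\hat G}(x).$$ Assume that the (finite) limits $\mathcal M(0)=\lim_{r\to0^+}\mathcal M(r)$ and $\mathcal M(\pi)=\lim_{r\to\pi^-}\mathcal M(r)$ exist and that $\sin^2(r)\,\bigl(R_{rr}-(n-1)\bigr)\in L^1(M,dr\,d\mu_{\hat G})$. Then $$\mathcal M(\pi)-\mathcal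 M(0)\ \ge\ \int_M \bigl(R_{rr}-(n-1)\bigr)\sin^2(r)\,dr\,d\mu_{\hat G},$$ with equality if and only if there is a smooth Riemannian metric $\widetilde G$ on $N$ (independent of $r$) such that $G(r)=\sin^2(r)\,\widetilde G$ for all $r\in(0,\pi)$. Moreover, suppose that $g$ is asymptotic to $g_0$ at some $r_0\in[0,\pi]$, that is, with $\mathring G(r)=\sin^2(r)\,\hat G$, $\|G(r)-\mathring G(r)\|_{\mathring G(r)}\to0$ uniformly on $N$ as $r\to r_0$, $r\in(0,\pi)$ (if $r_0\in(0,\pi)$, this means that $G(r_0)=\mathring G(r_0)$). Then equality holds if and only if $g=g_0$. -/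

import Mathlib

open Set Filter Topology MeasureTheory Bundle
open scoped Manifold ContDiff

noncomputable section

namespace RadialMass

/-! ### Riemannian geometry in coordinates

`F` is a coordinate space, `s` the set in which the coordinates vary (derivatives are taken within
`s`, so that boundary points are allowed), and `g` the coordinate expression of a metric. -/

section Coordinates

variable {F : Type*} [NormedAddCommGroup F] [NormedSpace ℝ F]

/-- The Christoffel symbol `Γ(u, v)` at `p`, as a vector: the solution of
`g (Γ(u, v), w) = (D_u g(v, w) + D_v g(u, w) - D_w g(u, v)) / 2` for all `w`. For coordinate
vector fields it is the Levi-Civita derivative `∇_u v`. -/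
def christoffel (g : F → F →L[ℝ] F →L[ℝ] ℝ) (s : Set F) (p u v : F) : F :=
  (g p).inverse ((1 / 2 : ℝ) •
    (fderivWithin ℝ (fun q => g q v) s p u + fderivWithin ℝ (fun q => g q u) s p v
      - fderivWithin ℝ (fun q => g q u v) s p))

/-- The Riemann curvature `R(u, v) w = ∇_u ∇_v w - ∇_v ∇_u w` of coordinate vector fields. -/
def curvature (g : F → F →L[ℝ] F →L[ℝ] ℝ) (s : Set F) (p u v w : F) : F :=
  fderivWithin ℝ (fun q => christoffel g s q v w) s p u
    - fderivWithin ℝ (fun q => christoffel g s q u w) s p v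
    + christoffel g s p u (christoffel g s p v w)
    - christoffel g s p v (christoffel g s p u w)

variable {d : ℕ}

/-- The Ricci curvature `Ric(v, w) = tr (u ↦ R(u, v) w)` in coordinates
`(r, y) ∈ ℝ × ℝ^d`, the trace being computed in the standard basis. -/
def ricci (g : ℝ × EuclideanSpace ℝ (Fin d) →
      ℝ × EuclideanSpace ℝ (Fin d) →L[ℝ] ℝ × EuclideanSpace ℝ (Fin d) →L[ℝ] ℝ)
    (s : Set (ℝ × EuclideanSpace ℝ (Fin d))) (p v w : ℝ × EuclideanSpace ℝ (Fin d)) : ℝ :=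
  (curvature g s p (1, 0) v w).1
    + ∑ A : Fin d, (curvature g s p (0, EuclideanSpace.single A 1) v w).2 A

/-- The mean curvature of a level set of `r` with respect to `∂_r`, in coordinates `(r, y)` in
which `∂_r` is a unit normal: the trace of the Weingarten map `v ↦ ∇_v ∂_r` on the level set. -/
def levelMeanCurvature (g : ℝ × EuclideanSpace ℝ (Fin d) →
      ℝ × EuclideanSpace ℝ (Fin d) →L[ℝ] ℝ × EuclideanSpace ℝ (Fin d) →L[ℝ] ℝ)
    (s : Set (ℝ × EuclideanSpace ℝ (Fin d))) (p : ℝ × EuclideanSpace ℝ (Fin d)) : ℝ :=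
  ∑ A : Fin d, (christoffel g s p (0, EuclideanSpace.single A 1) (1, 0)).2 A

end Coordinates

/-! ### Metrics on `N` and on `(a, b) × N` -/

section Manifold

variable {d : ℕ} {H : Type*} [TopologicalSpace H]
  (I : ModelWithCorners ℝ (EuclideanSpace ℝ (Fin d)) H)
  {N : Type*} [TopologicalSpace N] [ChartedSpace H N]

/-- The coordinate expression, in the chart of `N` around `x₀`, of a field `k` of bilinear forms
on the tangent spaces of `N`: its pullback under the inverse of the chart. -/
def chartForm (k : ∀ x : N, TangentSpace I x →L[ℝ] TangentSpace I x →L[ℝ] ℝ) (x₀ : N)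
    (y : EuclideanSpace ℝ (Fin d)) :
    EuclideanSpace ℝ (Fin d) →L[ℝ] EuclideanSpace ℝ (Fin d) →L[ℝ] ℝ :=
  letI A : EuclideanSpace ℝ (Fin d) →L[ℝ] EuclideanSpace ℝ (Fin d) :=
    mfderivWithin 𝓘(ℝ, EuclideanSpace ℝ (Fin d)) I (extChartAt I x₀).symm (range I) y
  letI B : EuclideanSpace ℝ (Fin d) →L[ℝ] EuclideanSpace ℝ (Fin d) →L[ℝ] ℝ :=
    k ((extChartAt I x₀).symm y)
  B.bilinearComp A A

/-- The Riemannian volume density `√(det k_{AB})` in the chart around `x₀`. -/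
def volumeDensity (k : ∀ x : N, TangentSpace I x →L[ℝ] TangentSpace I x →L[ℝ] ℝ) (x₀ : N)
    (y : EuclideanSpace ℝ (Fin d)) : ℝ :=
  √(Matrix.det (Matrix.of fun A B : Fin d =>
    chartForm I k x₀ y (EuclideanSpace.single A 1) (EuclideanSpace.single B 1)))

/-- The Riemannian volume of `k` on the domain of the chart around `x₀` (and zero elsewhere):
the image under the inverse chart of `√(det k_{AB}) dy`. -/
def chartVolume [MeasurableSpace N]
    (k : ∀ x : N, TangentSpace I x →L[ℝ] TangentSpace I x →L[ℝ] ℝ) (x₀ : N) : Measure N :=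
  (((volume : Measure (EuclideanSpace ℝ (Fin d))).restrict (extChartAt I x₀).target).withDensity
    (fun y => ENNReal.ofReal (volumeDensity I k x₀ y))).map (extChartAt I x₀).symm

/-- The Riemannian volume measure `dμ_k` of the metric `k`: the least measure that dominates
the volume in every chart. On the domain of each chart it coincides with the
volume in that chart, see `riemannianVolume_restrict_source`. -/
def riemannianVolume [MeasurableSpace N]
    (k : ∀ x : N, TangentSpace I x →L[ℝ] TangentSpace I x →L[ℝ] ℝ) : Measure N :=
  ⨆ x₀ : N, chartVolume I k x₀

/-- `G(r)`, `r ∈ J`, is a family of Riemannian metrics on `N`, smooth jointly in `r` and `x`;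
that is, `dr² + G(r)` is a smooth Riemannian metric on `J × N`. -/
structure IsSmoothMetricFamily [IsManifold I 1 N] (J : Set ℝ)
    (G : ℝ → ∀ x : N, TangentSpace I x →L[ℝ] TangentSpace I x →L[ℝ] ℝ) : Prop where
  symm : ∀ r ∈ J, ∀ (x : N) (v w : TangentSpace I x), G r x v w = G r x w v
  pos : ∀ r ∈ J, ∀ (x : N) (v : TangentSpace I x), v ≠ 0 → 0 < G r x v v
  contMDiffOn : ContMDiffOn (𝓘(ℝ, ℝ).prod I)
    (I.prod 𝓘(ℝ, EuclideanSpace ℝ (Fin d) →L[ℝ] EuclideanSpace ℝ (Fin d) →L[ℝ] ℝ)) ∞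
    (fun p : ℝ × N => TotalSpace.mk'
      (E := fun x : N => TangentSpace I x →L[ℝ] TangentSpace I x →L[ℝ] ℝ)
      (EuclideanSpace ℝ (Fin d) →L[ℝ] EuclideanSpace ℝ (Fin d) →L[ℝ] ℝ) p.2 (G p.1 p.2))
    (J ×ˢ univ)

/-- The metric `dr² + G(r)` in the adapted coordinates `(r, y)`, where `y` are the coordinates of
the chart of `N` around `x₀`. -/
def radialMetric (G : ℝ → ∀ x : N, TangentSpace I x →L[ℝ] TangentSpace I x →L[ℝ] ℝ) (x₀ : N)
    (p : ℝ × EuclideanSpace ℝ (Fin d)) :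
    ℝ × EuclideanSpace ℝ (Fin d) →L[ℝ] ℝ × EuclideanSpace ℝ (Fin d) →L[ℝ] ℝ :=
  (ContinuousLinearMap.mul ℝ ℝ).bilinearComp (ContinuousLinearMap.fst ℝ _ _)
      (ContinuousLinearMap.fst ℝ _ _)
    + (chartForm I (G p.1) x₀ p.2).bilinearComp (ContinuousLinearMap.snd ℝ _ _)
      (ContinuousLinearMap.snd ℝ _ _)

/-- The Ricci curvature `R_{rr} = Ric(∂_r, ∂_r)` of `dr² + G(r)` at `(r, x)`. -/
def ricciRadial (G : ℝ → ∀ x : N, TangentSpace I x →L[ℝ] TangentSpace I x →L[ℝ] ℝ)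
    (r : ℝ) (x : N) : ℝ :=
  ricci (radialMetric I G x) (univ ×ˢ (extChartAt I x).target) (r, extChartAt I x x) (1, 0) (1, 0)

/-- The mean curvature, at `(r, x)`, of the level set `{r} × N` relative to `dr² + G(r)`. -/
def meanCurvature (G : ℝ → ∀ x : N, TangentSpace I x →L[ℝ] TangentSpace I x →L[ℝ] ℝ)
    (r : ℝ) (x : N) : ℝ :=
  levelMeanCurvature (radialMetric I G x) (univ ×ˢ (extChartAt I x).target)
    (r, extChartAt I x x)

/-- The family `r ↦ h(r)² k` of the warped product `dr² + h² k`. -/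
def warped (h : ℝ → ℝ) (k : ∀ x : N, TangentSpace I x →L[ℝ] TangentSpace I x →L[ℝ] ℝ) :
    ℝ → ∀ x : N, TangentSpace I x →L[ℝ] TangentSpace I x →L[ℝ] ℝ :=
  fun r x => h r ^ 2 • k x

/-- The radial mass `m(r, x) = h² (H₀ - H)` of `dr² + G(r)` relative to `dr² + h² k`. -/
def mass (h : ℝ → ℝ) (k : ∀ x : N, TangentSpace I x →L[ℝ] TangentSpace I x →L[ℝ] ℝ)
    (G : ℝ → ∀ x : N, TangentSpace I x →L[ℝ] TangentSpace I x →L[ℝ] ℝ) (r : ℝ) (x : N) : ℝ :=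
  h r ^ 2 * (meanCurvature I (warped I h k) r x - meanCurvature I G r x)

/-- The radial mass `ℳ(r) = ∫_N m(r, x) dμ_k(x)` on `{r} × N`. -/
def totalMass [MeasurableSpace N]
    (h : ℝ → ℝ) (k : ∀ x : N, TangentSpace I x →L[ℝ] TangentSpace I x →L[ℝ] ℝ)
    (G : ℝ → ∀ x : N, TangentSpace I x →L[ℝ] TangentSpace I x →L[ℝ] ℝ) (r : ℝ) : ℝ :=
  ∫ x, mass I h k G r x ∂(riemannianVolume I k)

/-- `dr² + G(r)` is asymptotic at `r₀` to `dr² + G₀(r)` on `J × N`: the norm of `G - G₀`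
measured by `G₀` tends to `0` as `r → r₀`, `r ∈ J`, uniformly on `N`. Here `ε` bounds
the operator norm with respect to `G₀`, which is equivalent to every other tensor norm, with
constants depending on the dimension only. If `r₀ ∈ J`, then `r = r₀` is included, so
that `G` and `G₀` coincide at `r₀`. -/
def IsAsymptoticAt (J : Set ℝ)
    (G G₀ : ℝ → ∀ x : N, TangentSpace I x →L[ℝ] TangentSpace I x →L[ℝ] ℝ) (r₀ : ℝ) : Prop :=
  ∀ ε > 0, ∀ᶠ r in 𝓝[J] r₀, ∀ (x : N) (v w : TangentSpace I x),
    |G r x v w - G₀ r x v w| ≤ ε * (√(G₀ r x v v) * √(G₀ r x w w))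

end Manifold

/-! ### The volume measure in charts -/

section Volume

variable {d : ℕ} {H : Type*} [TopologicalSpace H]
  (I : ModelWithCorners ℝ (EuclideanSpace ℝ (Fin d)) H)
  {N : Type*} [TopologicalSpace N] [ChartedSpace H N]

theorem measurableSet_extChartAt_target (x₀ : N) :
    MeasurableSet (extChartAt I x₀).target := by
  rw [extChartAt_target]
  exact ((chartAt H x₀).open_target.preimage I.continuous_symm).measurableSet.inter
    I.isClosed_range.measurableSet

variable [IsManifold I 1 N]

theorem mfderivWithin_symm_eq {x₀ p : N} (hp : p ∈ (chartAt H x₀).source) :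
    mfderivWithin 𝓘(ℝ, EuclideanSpace ℝ (Fin d)) I (extChartAt I x₀).symm (range I)
      (extChartAt I x₀ p) = tangentCoordChange I x₀ p p := by
  rw [← TangentBundle.symmL_trivializationAt hp, TangentBundle.symmL_trivializationAt_eq_core hp]

theorem chartForm_eq (k : ∀ x : N, TangentSpace I x →L[ℝ] TangentSpace I x →L[ℝ] ℝ) {x₀ p : N}
    (hp : p ∈ (chartAt H x₀).source) (v w : EuclideanSpace ℝ (Fin d)) :
    chartForm I k x₀ (extChartAt I x₀ p) v w
      = k p (tangentCoordChange I x₀ p p v) (tangentCoordChange I x₀ p p w) := by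
  have h2 : (extChartAt I x₀).symm (extChartAt I x₀ p) = p :=
    (extChartAt I x₀).left_inv (by simpa using hp)
  unfold chartForm
  rw [mfderivWithin_symm_eq I hp, h2]
  rfl

theorem chartForm_change (k : ∀ x : N, TangentSpace I x →L[ℝ] TangentSpace I x →L[ℝ] ℝ)
    {x₀ x₁ p : N} (hp : p ∈ (chartAt H x₀).source) (hp' : p ∈ (chartAt H x₁).source)
    (v w : EuclideanSpace ℝ (Fin d)) :
    chartForm I k x₀ (extChartAt I x₀ p) v w
      = chartForm I k x₁ (extChartAt I x₁ p) (tangentCoordChange I x₀ x₁ p v)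
          (tangentCoordChange I x₀ x₁ p w) := by
  rw [chartForm_eq I k hp, chartForm_eq I k hp']
  rw [tangentCoordChange_comp, tangentCoordChange_comp] <;> simp [hp, hp']

theorem volumeDensity_change (k : ∀ x : N, TangentSpace I x →L[ℝ] TangentSpace I x →L[ℝ] ℝ)
    {x₀ x₁ p : N} (hp : p ∈ (chartAt H x₀).source) (hp' : p ∈ (chartAt H x₁).source) :
    volumeDensity I k x₀ (extChartAt I x₀ p)
      = |(tangentCoordChange I x₀ x₁ p).det| * volumeDensity I k x₁ (extChartAt I x₁ p) := by
  unfold volumeDensity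
  set L := tangentCoordChange I x₀ x₁ p
  set b := (EuclideanSpace.basisFun (Fin d) ℝ).toBasis
  set P := LinearMap.toMatrix b b (L : EuclideanSpace ℝ (Fin d) →ₗ[ℝ] EuclideanSpace ℝ (Fin d))
    with hP
  have hL (A : Fin d) : L (EuclideanSpace.single A 1)
      = ∑ C, P C A • EuclideanSpace.single C (1 : ℝ) := by
    have := (b.sum_repr (L (b A))).symm
    simpa [b, P, LinearMap.toMatrix_apply] using this
  have key : (Matrix.of fun A B : Fin d => chartForm I k x₀ (extChartAt I x₀ p)
        (EuclideanSpace.single A 1) (EuclideanSpace.single B 1))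
      = P.transpose * (Matrix.of fun A B : Fin d => chartForm I k x₁ (extChartAt I x₁ p)
        (EuclideanSpace.single A 1) (EuclideanSpace.single B 1)) * P := by
    ext A B
    rw [Matrix.of_apply, chartForm_change I k hp hp']
    change chartForm I k x₁ (extChartAt I x₁ p) (L _) (L _) = _
    rw [hL, hL]
    simp only [map_sum, map_smul, sum_apply, smul_apply,
      Matrix.mul_apply, Matrix.transpose_apply, Matrix.of_apply, smul_eq_mul, Finset.sum_mul,
      Finset.mul_sum]
    refine Finset.sum_congr rfl fun i _ => Finset.sum_congr rfl fun j _ => ?_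
    ring
  have hdet : L.det = P.det := by
    rw [hP, LinearMap.det_toMatrix]
  rw [key, Matrix.det_mul, Matrix.det_mul, Matrix.det_transpose, hdet]
  rw [show ∀ a c : ℝ, a * c * a = a ^ 2 * c from fun a c => by ring,
    Real.sqrt_mul (sq_nonneg _), Real.sqrt_sq_eq_abs]

variable [MeasurableSpace N] [BorelSpace N]

theorem chartVolume_apply (k : ∀ x : N, TangentSpace I x →L[ℝ] TangentSpace I x →L[ℝ] ℝ) (x₀ : N)
    {s : Set N} (hs : MeasurableSet s) :
    chartVolume I k x₀ s = ∫⁻ y in (extChartAt I x₀).symm ⁻¹' s ∩ (extChartAt I x₀).target,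
      ENNReal.ofReal (volumeDensity I k x₀ y) := by
  have hT := measurableSet_extChartAt_target I x₀
  unfold chartVolume
  rw [Measure.map_apply_of_aemeasurable _ hs, withDensity_apply', Measure.restrict_restrict' hT]
  exact ((continuousOn_extChartAt_symm x₀).aemeasurable hT).mono_ac
    (withDensity_absolutelyContinuous _ _)

theorem chartVolume_inter (k : ∀ x : N, TangentSpace I x →L[ℝ] TangentSpace I x →L[ℝ] ℝ)
    (x₀ x₁ : N) {s : Set N} (hs : MeasurableSet s) (h₀ : s ⊆ (chartAt H x₀).source)
    (h₁ : s ⊆ (chartAt H x₁).source) :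
    chartVolume I k x₀ s = chartVolume I k x₁ s := by
  have hset (x : N) (h : s ⊆ (chartAt H x).source) :
      (extChartAt I x).symm ⁻¹' s ∩ (extChartAt I x).target = extChartAt I x '' s := by
    ext y
    constructor
    · rintro ⟨h1, h2⟩
      exact ⟨_, h1, (extChartAt I x).right_inv h2⟩
    · rintro ⟨q, hq, rfl⟩
      have hq' : q ∈ (extChartAt I x).source := by simpa using h hq
      refine ⟨?_, (extChartAt I x).map_source hq'⟩
      rw [mem_preimage, (extChartAt I x).left_inv hq']
      exact hq
  have hmeas : MeasurableSet (extChartAt I x₀ '' s) := by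
    rw [← hset x₀ h₀]
    have hc : Continuous ((extChartAt I x₀).target.domRestrict (extChartAt I x₀).symm) :=
      (continuousOn_extChartAt_symm x₀).domRestrict
    have := (measurableSet_extChartAt_target I x₀).subtype_image (hc.measurable hs)
    convert this using 1
    ext y
    simp [and_comm]
  rw [chartVolume_apply I k x₀ hs, chartVolume_apply I k x₁ hs, hset x₀ h₀, hset x₁ h₁]
  have himg : extChartAt I x₁ '' s
      = (extChartAt I x₁ ∘ (extChartAt I x₀).symm) '' (extChartAt I x₀ '' s) := by
    rw [image_image]
    refine image_congr fun q hq => ?_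
    rw [Function.comp_apply,
      (extChartAt I x₀).left_inv (show q ∈ (extChartAt I x₀).source by simpa using h₀ hq)]
  have hinv (q : N) (hq : q ∈ s) : (extChartAt I x₀).symm (extChartAt I x₀ q) = q :=
    (extChartAt I x₀).left_inv (by simpa using h₀ hq)
  rw [himg, lintegral_image_eq_lintegral_abs_det_fderiv_mul volume hmeas
    (f' := fun y => tangentCoordChange I x₀ x₁ ((extChartAt I x₀).symm y))]
  · refine setLIntegral_congr_fun hmeas ?_
    rintro _ ⟨q, hq, rfl⟩
    simp only [Function.comp_apply, hinv q hq]
    rw [volumeDensity_change I k (h₀ hq) (h₁ hq), ENNReal.ofReal_mul (abs_nonneg _)]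
  · rintro _ ⟨q, hq, rfl⟩
    rw [hinv q hq]
    refine (hasFDerivWithinAt_tangentCoordChange ?_).mono ?_
    · exact ⟨by simpa using h₀ hq, by simpa using h₁ hq⟩
    · rintro _ ⟨q, _, rfl⟩
      simp [extChartAt]
  · rintro _ ⟨q, hq, rfl⟩ _ ⟨q', hq', rfl⟩ h
    simp only [Function.comp_apply, hinv q hq, hinv q' hq'] at h
    rw [(extChartAt I x₁).injOn (by simpa using h₁ hq) (by simpa using h₁ hq') h]

/-- The Riemannian volume is given by `√(det k_{AB}) dy` in every chart. -/
theorem riemannianVolume_restrict_source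
    (k : ∀ x : N, TangentSpace I x →L[ℝ] TangentSpace I x →L[ℝ] ℝ) (x₀ : N) :
    (riemannianVolume I k).restrict (chartAt H x₀).source = chartVolume I k x₀ := by
  have hU (x : N) : MeasurableSet (chartAt H x).source := (chartAt H x).open_source.measurableSet
  have hout (x : N) (s : Set N) (hs : MeasurableSet s) :
      chartVolume I k x (s ∩ (chartAt H x).source) = chartVolume I k x s := by
    rw [chartVolume_apply I k x (hs.inter (hU x)), chartVolume_apply I k x hs]
    congr 2
    ext y
    simp only [mem_inter_iff, mem_preimage, and_congr_left_iff, and_iff_left_iff_imp]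
    intro hy _
    simpa using (extChartAt I x).map_target hy
  apply le_antisymm
  · have hle : riemannianVolume I k
        ≤ chartVolume I k x₀ + (⊤ : Measure N).restrict (chartAt H x₀).sourceᶜ := by
      refine iSup_le fun x => Measure.le_iff.2 fun s hs => ?_
      rw [Measure.add_apply, Measure.restrict_apply hs,
        ← measure_inter_add_sdiff s (hU x₀) (μ := chartVolume I k x), sdiff_eq]
      refine add_le_add ?_ (Measure.le_iff'.1 le_top _)
      rw [← hout x _ (hs.inter (hU x₀)), chartVolume_inter I k x x₀
        ((hs.inter (hU x₀)).inter (hU x)) inter_subset_right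
        (inter_subset_left.trans inter_subset_right)]
      exact measure_mono (inter_subset_left.trans inter_subset_left)
    refine (Measure.restrict_mono le_rfl hle).trans ?_
    rw [Measure.restrict_add, Measure.restrict_restrict (hU x₀), inter_compl_self,
      Measure.restrict_empty, add_zero]
    exact Measure.restrict_le_self
  · refine Measure.le_iff.2 fun s hs => ?_
    rw [Measure.restrict_apply hs, ← hout x₀ s hs]
    exact Measure.le_iff'.1 (le_iSup (fun x => chartVolume I k x) x₀) _

end Volume

end RadialMass

end

/-! Write `d = n - 1` and let `W = (1/2) G⁻¹ G'` be the Weingarten map of the level sets. Since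
`∂_r` is a unit geodesic field, its curvature is `R(v, ∂_r)∂_r = -W'v - W²v`, and the trace is the
Riccati equation `(tr W)' = -R_rr - tr W²` (`hasDerivAt_trace_shape`). The model has mean curvature
`d cot r`, so `m = d sin r cos r - sin² r tr W`, and differentiating gives `m' = (R_rr - d) sin² r +
Q` with `Q = tr ((cos r - sin r W)²)` (`hasDerivAt_mass`). As `W` is self-adjoint for `G(r)`, `Q` is
the trace of the square of a self-adjoint map, hence nonnegative, and it vanishes only if `W = cot
r` (`trace_sq_nonneg`, `eq_zero_of_trace_sq`).

Integrating over `(c, e) × N` by Fubini and exhausting `(0, π)`, the difference of the two sides of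
the inequality is the limit of the integrals of `Q` (`exists_tendsto_setIntegral`). If this limit is
zero, then `Q` vanishes almost everywhere, hence everywhere, because it is continuous and the
Riemannian volume charges open sets (`integral_le_totalMass_sub`). Then `G' = 2 cot r G`, so `G /
sin²` is constant in `r`; the converse is a direct computation. Under the asymptotic condition the
factor `sin²` cancels from the comparison of the two metrics, which forces the constant to be the
given metric on `N` (`eq_of_isAsymptoticAt`). -/

noncomputable section

namespace RadialMass

/-! ### Positive definite forms and their self-adjoint maps. -/

section LinearAlgebra

variable {E : Type*} [NormedAddCommGroup E] [NormedSpace ℝ E]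

/-- The Weingarten map `(1 / 2) b⁻¹ b'` of a family of metrics with value `b` and derivative
`b'`. -/
def weingarten (b b' : E →L[ℝ] E →L[ℝ] ℝ) : E →L[ℝ] E := b.inverse ∘L ((1 / 2 : ℝ) • b')

theorem apply_weingarten {b : E →L[ℝ] E →L[ℝ] ℝ} (hb : b.IsInvertible)
    (b' : E →L[ℝ] E →L[ℝ] ℝ) (u : E) : b (weingarten b b' u) = (1 / 2 : ℝ) • b' u := by
  obtain ⟨e, rfl⟩ := hb
  simp [weingarten]

theorem fderivWithin_clm_comp {F A B : Type*} [NormedAddCommGroup F] [NormedSpace ℝ F]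
    [NormedAddCommGroup A] [NormedSpace ℝ A] [NormedAddCommGroup B] [NormedSpace ℝ B]
    (Λ : A →L[ℝ] B) {f : F → A} {s : Set F} {p : F} (hs : UniqueDiffWithinAt ℝ s p)
    (hf : DifferentiableWithinAt ℝ f s p) (u : F) :
    fderivWithin ℝ (fun q => Λ (f q)) s p u = Λ (fderivWithin ℝ f s p u) :=
  congrArg (fun L : F →L[ℝ] B => L u)
    ((Λ.hasFDerivAt.comp_hasFDerivWithinAt p hf.hasFDerivWithinAt).fderivWithin hs)

variable [FiniteDimensional ℝ E]

/-- Positivity makes `b` injective, and `E` and its dual have the same finite dimension. -/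
theorem isInvertible_of_pos {b : E →L[ℝ] E →L[ℝ] ℝ} (hb : ∀ v, v ≠ 0 → 0 < b v v) :
    b.IsInvertible := by
  have hinj : Function.Injective (b : E →ₗ[ℝ] E →L[ℝ] ℝ) := by
    rw [injective_iff_map_eq_zero]
    intro v hv
    by_contra h
    have := hb v h
    rw [show b v = 0 from hv] at this
    simp at this
  have hdim : Module.finrank ℝ E = Module.finrank ℝ (E →L[ℝ] ℝ) := by
    rw [← (LinearMap.toContinuousLinearMap (𝕜 := ℝ) (E := E) (F' := ℝ)).finrank_eq]
    exact Subspace.dual_finrank_eq.symm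
  refine ⟨(LinearMap.linearEquivOfInjective _ hinj hdim).toContinuousLinearEquiv, ?_⟩
  ext v w
  rfl

/-- The trace of the square of a self-adjoint map is a sum of squares. -/
theorem exists_basis_trace_sq {b : E →L[ℝ] E →L[ℝ] ℝ} (hs : ∀ v w, b v w = b w v)
    (hb : ∀ v, v ≠ 0 → 0 < b v v) {A : E →L[ℝ] E} (hA : ∀ v w, b (A v) w = b v (A w)) :
    ∃ e : Module.Basis (Fin (Module.finrank ℝ E)) ℝ E,
      LinearMap.trace ℝ E (A ∘L A : E →L[ℝ] E)
        = ∑ i, b (A (e i)) (A (e i)) / b (e i) (e i) := by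
  let β : LinearMap.BilinForm ℝ E := LinearMap.mk₂ ℝ (fun v w => b v w)
    (by simp) (by simp) (by simp) (by simp)
  have hβ : LinearMap.IsSymm β := ⟨fun v w => hs v w⟩
  obtain ⟨e, he⟩ := LinearMap.BilinForm.exists_orthogonal_basis hβ
  refine ⟨e, ?_⟩
  rw [LinearMap.trace_eq_matrix_trace ℝ e, Matrix.trace]
  refine Finset.sum_congr rfl fun i _ => ?_
  have hpos := hb (e i) (e.ne_zero i)
  -- In a `b`-orthogonal basis the diagonal entry of `A²` is `b (A² eᵢ) eᵢ / b eᵢ eᵢ`;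
  -- self-adjointness moves one factor `A` to the other side.
  rw [eq_div_iff hpos.ne', Matrix.diag_apply, LinearMap.toMatrix_apply]
  have h1 : b (A (A (e i))) (e i) = e.repr (A (A (e i))) i * b (e i) (e i) := by
    conv_lhs => rw [← e.sum_repr (A (A (e i)))]
    rw [map_sum, sum_apply, Finset.sum_eq_single i]
    · simp
    · intro j _ hj
      have : b (e j) (e i) = 0 := he hj
      simp [this]
    · simp
  rw [← hA, h1]
  rfl

theorem trace_sq_nonneg {b : E →L[ℝ] E →L[ℝ] ℝ} (hs : ∀ v w, b v w = b w v)
    (hb : ∀ v, v ≠ 0 → 0 < b v v) {A : E →L[ℝ] E} (hA : ∀ v w, b (A v) w = b v (A w)) :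
    0 ≤ LinearMap.trace ℝ E (A ∘L A : E →L[ℝ] E) := by
  have hnn (v : E) : 0 ≤ b v v := by
    by_cases h : v = 0
    · simp [h]
    · exact (hb v h).le
  obtain ⟨e, he⟩ := exists_basis_trace_sq hs hb hA
  rw [he]
  exact Finset.sum_nonneg fun i _ => div_nonneg (hnn _) (hnn _)

theorem eq_zero_of_trace_sq {b : E →L[ℝ] E →L[ℝ] ℝ} (hs : ∀ v w, b v w = b w v)
    (hb : ∀ v, v ≠ 0 → 0 < b v v) {A : E →L[ℝ] E} (hA : ∀ v w, b (A v) w = b v (A w))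
    (h : LinearMap.trace ℝ E (A ∘L A : E →L[ℝ] E) = 0) : A = 0 := by
  have hnn (v : E) : 0 ≤ b v v := by
    by_cases h : v = 0
    · simp [h]
    · exact (hb v h).le
  obtain ⟨e, he⟩ := exists_basis_trace_sq hs hb hA
  rw [he, Finset.sum_eq_zero_iff_of_nonneg
    fun i _ => div_nonneg (hnn _) (hnn _)] at h
  have h0 : (A : E →ₗ[ℝ] E) = 0 := e.ext fun i => by
    by_contra hi
    have h1 := h i (Finset.mem_univ i)
    exact (div_pos (hb _ hi) (hb _ (e.ne_zero i))).ne' h1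
  ext v
  exact congrArg (fun L : E →ₗ[ℝ] E => L v) h0

end LinearAlgebra

/-! ### Differentiation in the radial direction. -/

section Slices

variable {E : Type*} [NormedAddCommGroup E] [NormedSpace ℝ E] {J : Set ℝ} {T : Set E}

omit [NormedSpace ℝ E] in
-- Coordinate derivatives are taken within `univ ×ˢ T`, while smoothness is known only on `J ×ˢ T`.
-- This reconciles the two sets.
theorem prod_mem_nhdsWithin_univ_prod (hJ : IsOpen J) {p : ℝ × E} (hp : p ∈ J ×ˢ T) :
    J ×ˢ T ∈ 𝓝[univ ×ˢ T] p := by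
  have h : J ×ˢ T = (univ ×ˢ T) ∩ (J ×ˢ univ) := by
    rw [prod_inter_prod, univ_inter, inter_univ]
  rw [h]
  exact inter_mem_nhdsWithin _ ((hJ.prod isOpen_univ).mem_nhds ⟨hp.1, mem_univ _⟩)

/-- The line `t ↦ (t, y)` never leaves `univ ×ˢ T`, so even over a boundary point `y` the derivative
within the set restricts to a two-sided derivative in `r`. -/
theorem hasDerivAt_slice {A : Type*} [NormedAddCommGroup A] [NormedSpace ℝ A] {f : ℝ × E → A}
    {r : ℝ} {y : E} (hf : DifferentiableWithinAt ℝ f (univ ×ˢ T) (r, y)) (hy : y ∈ T) :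
    HasDerivAt (fun t => f (t, y)) (fderivWithin ℝ f (univ ×ˢ T) (r, y) (1, 0)) r :=
  hf.hasFDerivWithinAt.comp_hasDerivAt (f := fun t : ℝ => (t, y)) r
    ((hasDerivAt_id r).prodMk (hasDerivAt_const r y))
    (Eventually.of_forall fun _ => ⟨mem_univ _, hy⟩)

theorem hasDerivAt_slice_clm {A B : Type*} [NormedAddCommGroup A] [NormedSpace ℝ A]
    [NormedAddCommGroup B] [NormedSpace ℝ B] (Λ : A →L[ℝ] B) {f : ℝ × E → A} {r : ℝ} {y : E}
    (hf : DifferentiableWithinAt ℝ f (univ ×ˢ T) (r, y)) (hy : y ∈ T) :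
    HasDerivAt (fun t => Λ (f (t, y))) (Λ (fderivWithin ℝ f (univ ×ˢ T) (r, y) (1, 0))) r :=
  Λ.hasFDerivAt.comp_hasDerivAt r (hasDerivAt_slice hf hy)

set_option synthInstance.maxHeartbeats 400000
set_option maxHeartbeats 1000000

variable {K : ℝ × E → E →L[ℝ] E →L[ℝ] ℝ}

theorem differentiableWithinAt_univ_prod (hJ : IsOpen J) (hK : ContDiffOn ℝ ∞ K (J ×ˢ T))
    {p : ℝ × E} (hp : p ∈ J ×ˢ T) : DifferentiableWithinAt ℝ K (univ ×ˢ T) p :=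
  (hK.differentiableOn (by simp) p hp).mono_of_mem_nhdsWithin
    (prod_mem_nhdsWithin_univ_prod hJ hp)

theorem hasDerivAt_apply_weingarten {r : ℝ} {y : E}
    (hK : DifferentiableWithinAt ℝ K (univ ×ˢ T) (r, y)) (hy : y ∈ T)
    (hinv : (K (r, y)).IsInvertible) (v w : E) :
    HasDerivAt (fun t => K (t, y) v w)
      (2 * K (r, y) (weingarten (K (r, y)) (fderivWithin ℝ K (univ ×ˢ T) (r, y) (1, 0)) v) w)
      r := by
  let Λ : (E →L[ℝ] E →L[ℝ] ℝ) →L[ℝ] ℝ :=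
    (ContinuousLinearMap.apply ℝ ℝ w) ∘L (ContinuousLinearMap.apply ℝ (E →L[ℝ] ℝ) v)
  have h := @hasDerivAt_slice_clm E _ _ T (E →L[ℝ] E →L[ℝ] ℝ) ℝ
    ContinuousLinearMap.toNormedAddCommGroup _ _ _ Λ K r y hK hy
  refine h.congr_deriv ?_
  change (fderivWithin ℝ K (univ ×ˢ T) (r, y) (1, 0)) v w = _
  rw [apply_weingarten hinv]
  simp

theorem contDiffOn_weingarten [FiniteDimensional ℝ E] (hJ : IsOpen J) (hT : UniqueDiffOn ℝ T)
    (hK : ContDiffOn ℝ ∞ K (J ×ˢ T)) (hinv : ∀ p ∈ J ×ˢ T, (K p).IsInvertible) :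
    ContDiffOn ℝ ∞ (fun p => weingarten (K p) (fderivWithin ℝ K (univ ×ˢ T) p (1, 0)))
      (J ×ˢ T) := by
  have hD : ContDiffOn ℝ ∞ (fun p => fderivWithin ℝ K (univ ×ˢ T) p (1, 0)) (J ×ˢ T) := by
    have h1 := (hK.fderivWithin (m := ∞) (hJ.uniqueDiffOn.prod hT) (by simp)).clm_apply
      (contDiffOn_const (c := ((1, 0) : ℝ × E)))
    refine h1.congr fun p hp => ?_
    -- `J ×ˢ T` is cut out of `univ ×ˢ T` by an open set, so the derivatives within the two sets
    -- agree on it.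
    have h2 : J ×ˢ T = (univ ×ˢ T) ∩ (J ×ˢ univ) := by
      rw [prod_inter_prod, univ_inter, inter_univ]
    rw [h2, fderivWithin_inter ((hJ.prod isOpen_univ).mem_nhds ⟨hp.1, mem_univ _⟩)]
  have hI : ContDiffOn ℝ ∞ (fun p => (K p).inverse) (J ×ˢ T) := fun p hp =>
    have := FiniteDimensional.complete ℝ E
    (hinv p hp).contDiffAt_map_inverse.comp_contDiffWithinAt p (hK p hp)
  exact hI.clm_comp (hD.const_smul (1 / 2 : ℝ))

end Slices

/-! ### Christoffel symbols of `dr² + b`. -/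

section RadialForm

variable {E : Type*} [NormedAddCommGroup E] [NormedSpace ℝ E]

/-- The form `dr² + b` on `ℝ × E`. -/
def radialForm (b : E →L[ℝ] E →L[ℝ] ℝ) : ℝ × E →L[ℝ] ℝ × E →L[ℝ] ℝ :=
  (ContinuousLinearMap.mul ℝ ℝ).bilinearComp (ContinuousLinearMap.fst ℝ _ _)
      (ContinuousLinearMap.fst ℝ _ _)
    + b.bilinearComp (ContinuousLinearMap.snd ℝ _ _) (ContinuousLinearMap.snd ℝ _ _)

theorem radialForm_apply (b : E →L[ℝ] E →L[ℝ] ℝ) (u v : ℝ × E) :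
    radialForm b u v = u.1 * v.1 + b u.2 v.2 := rfl

/-- The form is block diagonal, so a covector that kills `∂_r` is raised inside `E`. The Christoffel
symbols needed below involve no other covectors. -/
theorem radialForm_inverse [FiniteDimensional ℝ E] {b : E →L[ℝ] E →L[ℝ] ℝ} (hb : b.IsInvertible)
    (l : E →L[ℝ] ℝ) :
    (radialForm b).inverse (l ∘L ContinuousLinearMap.snd ℝ ℝ E) = (0, b.inverse l) := by
  have hker : LinearMap.ker (radialForm b : ℝ × E →ₗ[ℝ] ℝ × E →L[ℝ] ℝ) = ⊥ := by
    rw [LinearMap.ker_eq_bot']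
    intro v hv
    have h1 (w : ℝ × E) : v.1 * w.1 + b v.2 w.2 = 0 := by
      rw [← radialForm_apply, show radialForm b v = 0 from hv]
      rfl
    have h2 : v.1 = 0 := by simpa using h1 (1, 0)
    have h3 : b v.2 = 0 := by
      ext w
      simpa using h1 (0, w)
    obtain ⟨e, rfl⟩ := hb
    exact Prod.ext h2 (by simpa using h3)
  have hdim : Module.finrank ℝ (ℝ × E) = Module.finrank ℝ (ℝ × E →L[ℝ] ℝ) := by
    rw [← (LinearMap.toContinuousLinearMap (𝕜 := ℝ) (E := ℝ × E) (F' := ℝ)).finrank_eq]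
    exact Subspace.dual_finrank_eq.symm
  have hinv : (radialForm b).IsInvertible := by
    refine ⟨(LinearMap.linearEquivOfInjective _
      (LinearMap.ker_eq_bot.1 hker) hdim).toContinuousLinearEquiv, ?_⟩
    ext v w <;> rfl
  have happ : radialForm b (0, b.inverse l) = l ∘L ContinuousLinearMap.snd ℝ ℝ E := by
    have hl : b (b.inverse l) = l := by
      obtain ⟨e, rfl⟩ := hb
      simp
    ext w <;> simp [radialForm_apply, hl]
  obtain ⟨e, he⟩ := hinv
  rw [← happ, ← he]
  simp

variable {K : ℝ × E →
  E →L[ℝ] E →L[ℝ] ℝ}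
  {s : Set (ℝ × E)} {p : ℝ × E}

theorem fderivWithin_radialForm_fst :
    fderivWithin ℝ (fun q => radialForm (K q) (1, 0)) s p = 0 := by
  have : (fun q => radialForm (K q) (1, 0)) = fun _ => ContinuousLinearMap.fst ℝ ℝ E := by
    ext q w <;> simp [radialForm_apply]
  rw [this]
  simp

/-- The radial lines are geodesics: `g(∂_r, ·) = dr` and `g(∂_r, ∂_r) = 1` have constant
coefficients. Invertibility plays no role, since `inverse` is applied to zero. -/
theorem christoffel_fst_fst : christoffel (fun q => radialForm (K q)) s p (1, 0) (1, 0) = 0 := by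
  unfold christoffel
  have : (fun q => radialForm (K q) (1, 0) (1, 0)) = fun _ => (1 : ℝ) := by
    ext q
    simp [radialForm_apply]
  rw [fderivWithin_radialForm_fst, this]
  simp

theorem fderivWithin_radialForm_snd (hs : UniqueDiffWithinAt ℝ s p)
    (hK : DifferentiableWithinAt ℝ K s p) (e : E) (u : ℝ × E) :
    fderivWithin ℝ (fun q => radialForm (K q) (0, e)) s p u
      = (fderivWithin ℝ K s p u e) ∘L ContinuousLinearMap.snd ℝ ℝ E := by
  let Λ : (E →L[ℝ] E →L[ℝ] ℝ) →L[ℝ] (ℝ × E →L[ℝ] ℝ) :=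
    ((ContinuousLinearMap.compL ℝ (ℝ × E) E ℝ).flip (ContinuousLinearMap.snd ℝ ℝ E)) ∘L
      (ContinuousLinearMap.apply ℝ (E →L[ℝ] ℝ) e)
  have h1 : (fun q => radialForm (K q) (0, e)) = fun q => Λ (K q) := by
    ext q w <;> simp [radialForm_apply, Λ]
  rw [h1]
  exact @fderivWithin_clm_comp (ℝ × E) (E →L[ℝ] E →L[ℝ] ℝ) (ℝ × E →L[ℝ] ℝ) _ _
    ContinuousLinearMap.toNormedAddCommGroup _ _ _ Λ K s p hs hK u

/-- Of the three terms of the Koszul formula only `∂_r g(e, ·)` survives, the other two being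
derivatives of constants. -/
theorem christoffel_snd_fst [FiniteDimensional ℝ E] (hs : UniqueDiffWithinAt ℝ s p)
    (hK : DifferentiableWithinAt ℝ K s p) (hinv : (K p).IsInvertible) (e : E) :
    christoffel (fun q => radialForm (K q)) s p (0, e) (1, 0)
      = (0, weingarten (K p) (fderivWithin ℝ K s p (1, 0)) e) := by
  unfold christoffel
  have : (fun q => radialForm (K q) (0, e) (1, 0)) = fun _ => (0 : ℝ) := by
    ext q
    simp [radialForm_apply]
  rw [fderivWithin_radialForm_fst, this, fderivWithin_radialForm_snd hs hK]
  simp only [zero_apply, zero_add, fderivWithin_fun_const, Pi.zero_apply, sub_zero]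
  rw [← ContinuousLinearMap.smul_comp, radialForm_inverse hinv]
  simp [weingarten]

theorem christoffel_fst_snd [FiniteDimensional ℝ E] (hs : UniqueDiffWithinAt ℝ s p)
    (hK : DifferentiableWithinAt ℝ K s p) (hinv : (K p).IsInvertible) (e : E) :
    christoffel (fun q => radialForm (K q)) s p (1, 0) (0, e)
      = (0, weingarten (K p) (fderivWithin ℝ K s p (1, 0)) e) := by
  rw [← christoffel_snd_fst hs hK hinv]
  unfold christoffel
  have h1 : (fun q => radialForm (K q) (0, e) (1, 0)) = fun _ => (0 : ℝ) := by
    ext q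
    simp [radialForm_apply]
  have h2 : (fun q => radialForm (K q) (1, 0) (0, e)) = fun _ => (0 : ℝ) := by
    ext q
    simp [radialForm_apply]
  rw [h1, h2, add_comm (fderivWithin ℝ (fun q => radialForm (K q) (0, e)) s p (1, 0))]

end RadialForm

/-! ### Mean curvature and radial Ricci curvature in coordinates. -/

section RadialCoordinates

variable {d : ℕ}

theorem trace_eq_sum (A : EuclideanSpace ℝ (Fin d) →L[ℝ] EuclideanSpace ℝ (Fin d)) :
    LinearMap.trace ℝ (EuclideanSpace ℝ (Fin d))
      (A : EuclideanSpace ℝ (Fin d) →ₗ[ℝ] EuclideanSpace ℝ (Fin d))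
      = ∑ i, (A (EuclideanSpace.single i 1)) i := by
  rw [LinearMap.trace_eq_matrix_trace ℝ (EuclideanSpace.basisFun (Fin d) ℝ).toBasis, Matrix.trace]
  refine Finset.sum_congr rfl fun i _ => ?_
  simp [LinearMap.toMatrix_apply]

/-- The trace as a continuous linear functional. -/
def traceCLM (d : ℕ) : (EuclideanSpace ℝ (Fin d) →L[ℝ] EuclideanSpace ℝ (Fin d)) →L[ℝ] ℝ :=
  ∑ i, (EuclideanSpace.proj i) ∘L
    (ContinuousLinearMap.apply ℝ (EuclideanSpace ℝ (Fin d)) (EuclideanSpace.single i 1))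

theorem traceCLM_apply (A : EuclideanSpace ℝ (Fin d) →L[ℝ] EuclideanSpace ℝ (Fin d)) :
    traceCLM d A = LinearMap.trace ℝ (EuclideanSpace ℝ (Fin d))
      (A : EuclideanSpace ℝ (Fin d) →ₗ[ℝ] EuclideanSpace ℝ (Fin d)) := by
  rw [trace_eq_sum, traceCLM]
  simp [sum_apply]

variable {K : ℝ × EuclideanSpace ℝ (Fin d) →
  EuclideanSpace ℝ (Fin d) →L[ℝ] EuclideanSpace ℝ (Fin d) →L[ℝ] ℝ}
  {s : Set (ℝ × EuclideanSpace ℝ (Fin d))} {p : ℝ × EuclideanSpace ℝ (Fin d)}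

theorem levelMeanCurvature_radialForm (hs : UniqueDiffWithinAt ℝ s p)
    (hK : DifferentiableWithinAt ℝ K s p) (hinv : (K p).IsInvertible) :
    levelMeanCurvature (fun q => radialForm (K q)) s p
      = traceCLM d (weingarten (K p) (fderivWithin ℝ K s p (1, 0))) := by
  rw [traceCLM_apply, trace_eq_sum]
  unfold levelMeanCurvature
  simp only [christoffel_snd_fst hs hK hinv]

/-- As `∇_{∂_r} ∂_r = 0` and `∇_e ∂_r = W e`, the curvature `R(e, ∂_r)∂_r` reduces to `-∇_{∂_r}(W e)
= -W'e - W(W e)`. The identity for `∇_e ∂_r` is needed near `p`, not only at `p`, because it gets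
differentiated. -/
theorem ricci_radialForm (hps : p ∈ s) (hs : UniqueDiffWithinAt ℝ s p)
    (h : ∀ᶠ q in 𝓝[s] p, UniqueDiffWithinAt ℝ s q ∧ DifferentiableWithinAt ℝ K s q ∧
      (K q).IsInvertible)
    (hW : DifferentiableWithinAt ℝ
      (fun q => weingarten (K q) (fderivWithin ℝ K s q (1, 0))) s p) :
    ricci (fun q => radialForm (K q)) s p (1, 0) (1, 0)
      = -traceCLM d (fderivWithin ℝ
          (fun q => weingarten (K q) (fderivWithin ℝ K s q (1, 0))) s p (1, 0))
        - traceCLM d (weingarten (K p) (fderivWithin ℝ K s p (1, 0)) ∘L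
          weingarten (K p) (fderivWithin ℝ K s p (1, 0))) := by
  obtain ⟨hp1, hp2, hp3⟩ := h.self_of_nhdsWithin hps
  set W := fun q => weingarten (K q) (fderivWithin ℝ K s q (1, 0)) with hWdef
  have hconst : (fun q => christoffel (fun q => radialForm (K q)) s q (1, 0) (1, 0))
      = fun _ => 0 := by
    ext1 q
    exact christoffel_fst_fst
  have hder (e : EuclideanSpace ℝ (Fin d)) : fderivWithin ℝ
      (fun q => christoffel (fun q => radialForm (K q)) s q (0, e) (1, 0)) s p (1, 0)
        = (0, fderivWithin ℝ W s p (1, 0) e) := by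
    have heq : (fun q => christoffel (fun q => radialForm (K q)) s q (0, e) (1, 0))
        =ᶠ[𝓝[s] p] fun q => ((0 : ℝ), W q e) := by
      filter_upwards [h] with q hq
      exact christoffel_snd_fst hq.1 hq.2.1 hq.2.2 e
    rw [heq.fderivWithin_eq (heq.self_of_nhdsWithin hps)]
    let Λ : (EuclideanSpace ℝ (Fin d) →L[ℝ] EuclideanSpace ℝ (Fin d)) →L[ℝ]
        (ℝ × EuclideanSpace ℝ (Fin d)) :=
      (ContinuousLinearMap.inr ℝ ℝ (EuclideanSpace ℝ (Fin d))) ∘L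
        (ContinuousLinearMap.apply ℝ (EuclideanSpace ℝ (Fin d)) e)
    have h1 : (fun q => ((0 : ℝ), W q e)) = fun q => Λ (W q) := by
      ext q <;> simp [Λ]
    rw [h1, fderivWithin_clm_comp Λ hs hW]
    rfl
  unfold ricci
  have hrr : curvature (fun q => radialForm (K q)) s p (1, 0) (1, 0) (1, 0) = 0 := by
    unfold curvature
    abel
  have hA (A : Fin d) : curvature (fun q => radialForm (K q)) s p
      (0, EuclideanSpace.single A 1) (1, 0) (1, 0)
        = (0, -(fderivWithin ℝ W s p (1, 0) (EuclideanSpace.single A 1))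
            - W p (W p (EuclideanSpace.single A 1))) := by
    unfold curvature
    rw [hder, hconst, christoffel_fst_fst, christoffel_snd_fst hp1 hp2 hp3,
      christoffel_fst_snd hp1 hp2 hp3]
    have h0 : christoffel (fun q => radialForm (K q)) s p (0, EuclideanSpace.single A 1) 0 = 0 := by
      simp [christoffel]
    rw [h0]
    simp [hWdef]
  rw [hrr]
  simp only [hA, traceCLM_apply, trace_eq_sum]
  simp [Finset.sum_sub_distrib, Finset.sum_neg_distrib, hWdef]

end RadialCoordinates

/-! ### From charts to the manifold: the Weingarten map and the Riccati equation. -/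

section Charts

variable {d : ℕ} {H : Type*} [TopologicalSpace H]
  (I : ModelWithCorners ℝ (EuclideanSpace ℝ (Fin d)) H)
  {N : Type*} [TopologicalSpace N] [ChartedSpace H N]

/-- The coordinate expression of a family of forms, as a function of `(r, y)`. -/
def familyForm (G : ℝ → ∀ x : N, TangentSpace I x →L[ℝ] TangentSpace I x →L[ℝ] ℝ) (x₀ : N)
    (p : ℝ × EuclideanSpace ℝ (Fin d)) :
    EuclideanSpace ℝ (Fin d) →L[ℝ] EuclideanSpace ℝ (Fin d) →L[ℝ] ℝ :=
  chartForm I (G p.1) x₀ p.2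

/-- The coordinate expression of the Weingarten map of the level sets. -/
def chartShape (G : ℝ → ∀ x : N, TangentSpace I x →L[ℝ] TangentSpace I x →L[ℝ] ℝ) (x₀ : N)
    (p : ℝ × EuclideanSpace ℝ (Fin d)) :
    EuclideanSpace ℝ (Fin d) →L[ℝ] EuclideanSpace ℝ (Fin d) :=
  weingarten (familyForm I G x₀ p)
    (fderivWithin ℝ (familyForm I G x₀) (univ ×ˢ (extChartAt I x₀).target) p (1, 0))

/-- The Weingarten map `X ↦ ∇_X ∂_r` of the level set `{r} × N` in `dr² + G(r)`, at `x`. -/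
def shape (G : ℝ → ∀ x : N, TangentSpace I x →L[ℝ] TangentSpace I x →L[ℝ] ℝ) (r : ℝ) (x : N) :
    EuclideanSpace ℝ (Fin d) →L[ℝ] EuclideanSpace ℝ (Fin d) :=
  chartShape I G x (r, extChartAt I x x)

theorem mem_prod_target {J : Set ℝ} {r : ℝ} (hr : r ∈ J) {x₀ p : N}
    (hp : p ∈ (chartAt H x₀).source) :
    (r, extChartAt I x₀ p) ∈ J ×ˢ (extChartAt I x₀).target :=
  ⟨hr, (extChartAt I x₀).map_source (by simpa using hp)⟩

variable [IsManifold I ∞ N]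

/-- The tangent coordinate change as a linear equivalence. -/
def coordChangeEquiv {x₀ x₁ p : N} (hp : p ∈ (chartAt H x₀).source)
    (hp' : p ∈ (chartAt H x₁).source) :
    EuclideanSpace ℝ (Fin d) ≃L[ℝ] EuclideanSpace ℝ (Fin d) :=
  ContinuousLinearEquiv.equivOfInverse (tangentCoordChange I x₀ x₁ p)
    (tangentCoordChange I x₁ x₀ p)
    (fun v => by
      rw [tangentCoordChange_comp (by simp [hp, hp']), tangentCoordChange_self (by simpa using hp)])
    (fun v => by
      rw [tangentCoordChange_comp (by simp [hp, hp']),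
        tangentCoordChange_self (by simpa using hp')])

/-- The coordinate expression of a form at `p`, in terms of the form itself. -/
theorem familyForm_apply (G : ℝ → ∀ x : N, TangentSpace I x →L[ℝ] TangentSpace I x →L[ℝ] ℝ)
    {x₀ p : N} (hp : p ∈ (chartAt H x₀).source) (r : ℝ) (v w : EuclideanSpace ℝ (Fin d)) :
    familyForm I G x₀ (r, extChartAt I x₀ p) v w
      = G r p (coordChangeEquiv I hp (mem_chart_source H p) v)
          (coordChangeEquiv I hp (mem_chart_source H p) w) :=
  chartForm_eq I (G r) hp v w

/-- At `x`, the chart around `x` induces the identity on the tangent space. This is why `shape`,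
computed in that chart, pairs with `G r x` directly. -/
theorem familyForm_self_apply
    (G : ℝ → ∀ x : N, TangentSpace I x →L[ℝ] TangentSpace I x →L[ℝ] ℝ)
    (r : ℝ) (x : N) (v w : EuclideanSpace ℝ (Fin d)) :
    familyForm I G x (r, extChartAt I x x) v w = G r x v w := by
  refine (chartForm_eq I (G r) (mem_chart_source H x) v w).trans ?_
  rw [tangentCoordChange_self (by simp), tangentCoordChange_self (by simp)]

variable {J : Set ℝ} {G : ℝ → ∀ x : N, TangentSpace I x →L[ℝ] TangentSpace I x →L[ℝ] ℝ}
  (hG : IsSmoothMetricFamily I J G)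
include hG

namespace IsSmoothMetricFamily

-- Smoothness of a section of the bundle of bilinear forms is smoothness in its trivialization at
-- `x₀`, and that trivialization is the pullback by the derivative of the inverse chart.
set_option synthInstance.maxHeartbeats 400000 in
set_option maxHeartbeats 1000000 in
theorem contDiffOn_familyForm (x₀ : N) :
    ContDiffOn ℝ ∞ (familyForm I G x₀) (J ×ˢ (extChartAt I x₀).target) := by
  have hφ : ContMDiffOn 𝓘(ℝ, ℝ × EuclideanSpace ℝ (Fin d)) (𝓘(ℝ, ℝ).prod I) ∞
      (fun p : ℝ × EuclideanSpace ℝ (Fin d) => (p.1, (extChartAt I x₀).symm p.2))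
      (J ×ˢ (extChartAt I x₀).target) := by
    refine ContMDiffOn.prodMk contDiff_fst.contMDiff.contMDiffOn ?_
    exact (contMDiffOn_extChartAt_symm x₀).comp contDiff_snd.contMDiff.contMDiffOn
      fun p hp => hp.2
  have hcomp := hG.contMDiffOn.comp hφ (t := J ×ˢ univ) fun p hp => ⟨hp.1, mem_univ _⟩
  rw [(trivializationAt (EuclideanSpace ℝ (Fin d) →L[ℝ] EuclideanSpace ℝ (Fin d) →L[ℝ] ℝ)
    (fun x : N => TangentSpace I x →L[ℝ] TangentSpace I x →L[ℝ] ℝ) x₀).contMDiffOn_iff] at hcomp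
  · refine (contMDiffOn_iff_contDiffOn.1 hcomp.2).congr fun p hp => ?_
    have hp' : (extChartAt I x₀).symm p.2 ∈ (chartAt H x₀).source := by
      simpa using (extChartAt I x₀).map_target hp.2
    ext v w
    rw [Function.comp_apply, hom_trivializationAt_apply,
      inCoordinates_apply_eq₂ (by simpa using hp') (by simpa using hp') (mem_univ _)]
    have h2 : extChartAt I x₀ ((extChartAt I x₀).symm p.2) = p.2 :=
      (extChartAt I x₀).right_inv hp.2
    have h3 := chartForm_eq I (G p.1) hp' v w
    rw [h2] at h3
    rw [familyForm, h3]
    have h4 := TangentBundle.symmL_trivializationAt_eq_core (I := I) hp'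
    have h5 (u : EuclideanSpace ℝ (Fin d)) :
        (trivializationAt (EuclideanSpace ℝ (Fin d)) (TangentSpace I) x₀).symm
          ((extChartAt I x₀).symm p.2) u
        = tangentCoordChange I x₀ ((extChartAt I x₀).symm p.2) ((extChartAt I x₀).symm p.2) u := by
      rw [← Trivialization.symmL_apply (R := ℝ) _ (by simpa using hp'), h4]
      rfl
    rw [h5, h5]
    simp
  · intro p hp
    have : (extChartAt I x₀).symm p.2 ∈ (chartAt H x₀).source := by
      simpa using (extChartAt I x₀).map_target hp.2
    simpa using this

theorem eq_of_forall_apply_eq {r : ℝ} (hr : r ∈ J) (x : N) {u v : EuclideanSpace ℝ (Fin d)}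
    (h : ∀ w : EuclideanSpace ℝ (Fin d), G r x u w = G r x v w) : u = v := by
  by_contra huv
  have hpos := hG.pos r hr x (u - v) (sub_ne_zero.2 huv)
  have h0 (B : EuclideanSpace ℝ (Fin d) →L[ℝ] EuclideanSpace ℝ (Fin d) →L[ℝ] ℝ)
      (hB : B u (u - v) = B v (u - v)) : B (u - v) (u - v) = 0 := by
    rw [map_sub B, sub_apply, hB, sub_self]
  exact hpos.ne' (h0 (G r x) (h _))

theorem isInvertible_familyForm {x₀ : N} {p : ℝ × EuclideanSpace ℝ (Fin d)}
    (hp : p ∈ J ×ˢ (extChartAt I x₀).target) : (familyForm I G x₀ p).IsInvertible := by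
  have hp' : (extChartAt I x₀).symm p.2 ∈ (chartAt H x₀).source := by
    simpa using (extChartAt I x₀).map_target hp.2
  have h2 : p = (p.1, extChartAt I x₀ ((extChartAt I x₀).symm p.2)) :=
    Prod.ext rfl ((extChartAt I x₀).right_inv hp.2).symm
  refine isInvertible_of_pos fun v hv => ?_
  rw [h2, familyForm_apply I G hp']
  exact hG.pos p.1 hp.1 _ _ fun h =>
    hv ((coordChangeEquiv I hp' (mem_chart_source H _)).map_eq_zero_iff.1 h)

theorem contDiffOn_chartShape (hJ : IsOpen J) (x₀ : N) :
    ContDiffOn ℝ ∞ (chartShape I G x₀) (J ×ˢ (extChartAt I x₀).target) :=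
  contDiffOn_weingarten hJ (uniqueDiffOn_extChartAt_target x₀) (hG.contDiffOn_familyForm I x₀)
    fun _ hp => hG.isInvertible_familyForm I hp

theorem hasDerivAt_familyForm_apply (hJ : IsOpen J) {r : ℝ} (hr : r ∈ J) {x₀ p : N}
    (hp : p ∈ (chartAt H x₀).source) (v w : EuclideanSpace ℝ (Fin d)) :
    HasDerivAt (fun t => familyForm I G x₀ (t, extChartAt I x₀ p) v w)
      (2 * familyForm I G x₀ (r, extChartAt I x₀ p)
        (chartShape I G x₀ (r, extChartAt I x₀ p) v) w) r :=
  hasDerivAt_apply_weingarten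
    (differentiableWithinAt_univ_prod hJ (hG.contDiffOn_familyForm I x₀) (mem_prod_target I hr hp))
    (mem_prod_target I hr hp).2 (hG.isInvertible_familyForm I (mem_prod_target I hr hp)) v w

/-- The Weingarten map is half of the logarithmic derivative of the metric. -/
theorem hasDerivAt_apply (hJ : IsOpen J) {r : ℝ} (hr : r ∈ J) (x : N)
    (v w : EuclideanSpace ℝ (Fin d)) :
    HasDerivAt (fun t => G t x v w) (2 * G r x (shape I G r x v) w) r := by
  have h := hG.hasDerivAt_familyForm_apply I hJ hr (mem_chart_source H x) v w
  simp only [familyForm_self_apply] at h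
  exact h

/-- The Weingarten map is determined by the `r`-derivative of the metric, and the coordinate change
does not depend on `r`. Comparing the derivatives of one and the same function in two charts gives
the conjugation, with no transformation law for Christoffel symbols. -/
theorem chartShape_eq (hJ : IsOpen J) {r : ℝ} (hr : r ∈ J) {x₀ p : N}
    (hp : p ∈ (chartAt H x₀).source) :
    chartShape I G x₀ (r, extChartAt I x₀ p)
      = ((coordChangeEquiv I hp (mem_chart_source H p)).symm :
          EuclideanSpace ℝ (Fin d) →L[ℝ] EuclideanSpace ℝ (Fin d)) ∘L shape I G r p ∘L
        (coordChangeEquiv I hp (mem_chart_source H p) :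
          EuclideanSpace ℝ (Fin d) →L[ℝ] EuclideanSpace ℝ (Fin d)) := by
  set T := coordChangeEquiv I hp (mem_chart_source H p) with hT
  ext1 v
  apply T.injective
  refine hG.eq_of_forall_apply_eq I hr p fun w => ?_
  have h1 := hG.hasDerivAt_familyForm_apply I hJ hr hp v (T.symm w)
  simp only [familyForm_apply I G hp, ← hT, T.apply_symm_apply] at h1
  have h2 := hG.hasDerivAt_apply I hJ hr p (T v) w
  have h3 := h1.unique h2
  simp only [ContinuousLinearMap.comp_apply, ContinuousLinearEquiv.coe_coe, T.apply_symm_apply]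
  linarith

/-- The derivative of a family of symmetric forms is symmetric. -/
theorem shape_self_adjoint (hJ : IsOpen J) {r : ℝ} (hr : r ∈ J) (x : N)
    (v w : EuclideanSpace ℝ (Fin d)) :
    G r x (shape I G r x v) w = G r x v (shape I G r x w) := by
  have h1 := hG.hasDerivAt_apply I hJ hr x v w
  have h2 : HasDerivAt (fun t => G t x v w) (2 * G r x (shape I G r x w) v) r := by
    refine (hG.hasDerivAt_apply I hJ hr x w v).congr_of_eventuallyEq ?_
    filter_upwards [hJ.mem_nhds hr] with t ht
    exact hG.symm t ht x v w
  exact (mul_left_cancel₀ two_ne_zero (h1.unique h2)).trans (hG.symm r hr x _ _)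

theorem trace_chartShape (hJ : IsOpen J) {r : ℝ} (hr : r ∈ J) {x₀ p : N}
    (hp : p ∈ (chartAt H x₀).source) :
    traceCLM d (chartShape I G x₀ (r, extChartAt I x₀ p)) = traceCLM d (shape I G r p) := by
  rw [hG.chartShape_eq I hJ hr hp, traceCLM_apply, traceCLM_apply]
  exact LinearMap.trace_conj' (shape I G r p : _ →ₗ[ℝ] _)
    (coordChangeEquiv I hp (mem_chart_source H p)).symm.toLinearEquiv

theorem trace_chartShape_sq (hJ : IsOpen J) {r : ℝ} (hr : r ∈ J)
    {x₀ p : N} (hp : p ∈ (chartAt H x₀).source) :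
    traceCLM d (chartShape I G x₀ (r, extChartAt I x₀ p) ∘L
      chartShape I G x₀ (r, extChartAt I x₀ p))
      = traceCLM d (shape I G r p ∘L shape I G r p) := by
  rw [hG.chartShape_eq I hJ hr hp, traceCLM_apply, traceCLM_apply]
  rw [← LinearMap.trace_conj' ((shape I G r p ∘L shape I G r p :
      EuclideanSpace ℝ (Fin d) →L[ℝ] EuclideanSpace ℝ (Fin d)) : _ →ₗ[ℝ] _)
    (coordChangeEquiv I hp (mem_chart_source H p)).symm.toLinearEquiv]
  congr 1
  ext v
  simp [LinearEquiv.conj_apply]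

theorem meanCurvature_eq (hJ : IsOpen J) {r : ℝ} (hr : r ∈ J) (x : N) :
    meanCurvature I G r x = traceCLM d (shape I G r x) := by
  have hmem := mem_prod_target I hr (mem_chart_source H x)
  exact levelMeanCurvature_radialForm (K := familyForm I G x)
    ((uniqueDiffOn_univ.prod (uniqueDiffOn_extChartAt_target x)) _ ⟨mem_univ _, hmem.2⟩)
    (differentiableWithinAt_univ_prod hJ (hG.contDiffOn_familyForm I x) hmem)
    (hG.isInvertible_familyForm I hmem)

/-- The Riccati equation for the mean curvature of the level sets. -/
theorem hasDerivAt_trace_shape (hJ : IsOpen J) {r : ℝ} (hr : r ∈ J) (x : N) :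
    HasDerivAt (fun t => traceCLM d (shape I G t x))
      (-ricciRadial I G r x - traceCLM d (shape I G r x ∘L shape I G r x)) r := by
  have hmem := mem_prod_target I hr (mem_chart_source H x)
  have huniq := uniqueDiffOn_univ.prod (uniqueDiffOn_extChartAt_target (I := I) x) (𝕜 := ℝ)
    (s := (univ : Set ℝ))
  have hnear := prod_mem_nhdsWithin_univ_prod hJ hmem
  have hW : DifferentiableWithinAt ℝ (chartShape I G x) (univ ×ˢ (extChartAt I x).target)
      (r, extChartAt I x x) :=
    ((hG.contDiffOn_chartShape I hJ x).differentiableOn (by simp) _ hmem).mono_of_mem_nhdsWithin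
      hnear
  have hric : ricciRadial I G r x
      = -traceCLM d (fderivWithin ℝ (chartShape I G x) (univ ×ˢ (extChartAt I x).target)
          (r, extChartAt I x x) (1, 0))
        - traceCLM d (shape I G r x ∘L shape I G r x) := by
    refine ricci_radialForm (K := familyForm I G x) ⟨mem_univ _, hmem.2⟩
      (huniq _ ⟨mem_univ _, hmem.2⟩) ?_ hW
    filter_upwards [hnear] with q hq
    exact ⟨huniq _ ⟨mem_univ _, hq.2⟩,
      differentiableWithinAt_univ_prod hJ (hG.contDiffOn_familyForm I x) hq,
      hG.isInvertible_familyForm I hq⟩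
  refine (hasDerivAt_slice_clm (traceCLM d) hW hmem.2).congr_deriv ?_
  rw [hric]
  ring

/-- `shape` uses a chart that varies with the point, possibly discontinuously. Quantities invariant
under conjugation, such as `tr W` and `tr W²`, can be read in one fixed chart near each point. -/
theorem continuousOn_of_chart (hJ : IsOpen J) {f : ℝ → N → ℝ}
    {Φ : (EuclideanSpace ℝ (Fin d) →L[ℝ] EuclideanSpace ℝ (Fin d)) → ℝ} (hΦ : Continuous Φ)
    (hf : ∀ r ∈ J, ∀ x₀ p : N, p ∈ (chartAt H x₀).source →
      f r p = Φ (chartShape I G x₀ (r, extChartAt I x₀ p))) :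
    ContinuousOn (fun p : ℝ × N => f p.1 p.2) (J ×ˢ univ) := by
  rintro ⟨r, x⟩ ⟨hr, -⟩
  have hS : J ×ˢ (chartAt H x).source ∈ 𝓝 (r, x) :=
    (hJ.prod (chartAt H x).open_source).mem_nhds ⟨hr, mem_chart_source H x⟩
  refine ContinuousAt.continuousWithinAt ?_
  have hc : ContinuousOn (fun p : ℝ × N => Φ (chartShape I G x (p.1, extChartAt I x p.2)))
      (J ×ˢ (chartAt H x).source) := by
    refine hΦ.comp_continuousOn ((hG.contDiffOn_chartShape I hJ x).continuousOn.comp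
      (continuousOn_fst.prodMk ((continuousOn_extChartAt x).comp continuousOn_snd ?_)) ?_)
    · intro p hp
      simpa using hp.2
    · intro p hp
      exact mem_prod_target I hp.1 hp.2
  refine (hc.continuousAt hS).congr ?_
  filter_upwards [hS] with p hp
  exact (hf p.1 hp.1 x p.2 hp.2).symm

theorem continuousOn_trace_shape (hJ : IsOpen J) :
    ContinuousOn (fun p : ℝ × N => traceCLM d (shape I G p.1 p.2)) (J ×ˢ univ) :=
  hG.continuousOn_of_chart I hJ (f := fun r x => traceCLM d (shape I G r x))
    (traceCLM d).continuous fun _ hr _ _ hp => (hG.trace_chartShape I hJ hr hp).symm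

theorem continuousOn_trace_shape_sq (hJ : IsOpen J) :
    ContinuousOn (fun p : ℝ × N => traceCLM d (shape I G p.1 p.2 ∘L shape I G p.1 p.2))
      (J ×ˢ univ) :=
  hG.continuousOn_of_chart I hJ (f := fun r x => traceCLM d (shape I G r x ∘L shape I G r x))
    (Φ := fun A => traceCLM d (A ∘L A))
    ((traceCLM d).continuous.comp (continuous_id.clm_comp continuous_id))
    fun _ hr _ _ hp => (hG.trace_chartShape_sq I hJ hr hp).symm

end IsSmoothMetricFamily

end Charts

/-! ### The Riemannian volume is finite and charges open sets. -/

section VolumeProperties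

variable {d : ℕ} {H : Type*} [TopologicalSpace H]
  (I : ModelWithCorners ℝ (EuclideanSpace ℝ (Fin d)) H)
  {N : Type*} [TopologicalSpace N] [ChartedSpace H N] [IsManifold I ∞ N]

theorem isSmoothMetricFamily_const
    (k : ContMDiffRiemannianMetric I ∞ (EuclideanSpace ℝ (Fin d)) (fun x : N => TangentSpace I x))
    (J : Set ℝ) : IsSmoothMetricFamily I J (fun _ => k.inner) where
  symm _ _ := k.symm
  pos _ _ := k.pos
  contMDiffOn := (k.contMDiff.comp contMDiff_snd).contMDiffOn

/-- The quadratic form of the Gram matrix at `c` is `b v v` with `v = ∑ c_A e_A`. -/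
theorem det_gram_pos {b : EuclideanSpace ℝ (Fin d) →L[ℝ] EuclideanSpace ℝ (Fin d) →L[ℝ] ℝ}
    (hs : ∀ v w, b v w = b w v) (hb : ∀ v, v ≠ 0 → 0 < b v v) :
    0 < Matrix.det (Matrix.of fun A B : Fin d =>
      b (EuclideanSpace.single A 1) (EuclideanSpace.single B 1)) := by
  refine (Matrix.PosDef.of_dotProduct_mulVec_pos ?_ fun c hc => ?_).det_pos
  · ext A B
    simp [hs (EuclideanSpace.single A 1)]
  · have hv : (∑ A, c A • EuclideanSpace.single A (1 : ℝ) : EuclideanSpace ℝ (Fin d)) ≠ 0 := by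
      intro h
      refine hc (funext fun A => ?_)
      have := congrArg (fun v : EuclideanSpace ℝ (Fin d) => v A) h
      simpa [Finset.sum_apply, Pi.single_apply] using this
    refine (hb _ hv).trans_eq ?_
    simp only [map_sum, map_smul, sum_apply, smul_apply, smul_eq_mul, dotProduct, Matrix.mulVec,
      Matrix.of_apply, star_trivial, Finset.mul_sum]
    rw [Finset.sum_comm]
    refine Finset.sum_congr rfl fun i _ => Finset.sum_congr rfl fun j _ => ?_
    ring

variable (k : ContMDiffRiemannianMetric I ∞ (EuclideanSpace ℝ (Fin d))
  (fun x : N => TangentSpace I x))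

theorem chartForm_symm_pos (x₀ : N) {y : EuclideanSpace ℝ (Fin d)}
    (hy : y ∈ (extChartAt I x₀).target) :
    (∀ v w, chartForm I k.inner x₀ y v w = chartForm I k.inner x₀ y w v) ∧
      ∀ v, v ≠ 0 → 0 < chartForm I k.inner x₀ y v v := by
  have hp : (extChartAt I x₀).symm y ∈ (chartAt H x₀).source := by
    simpa using (extChartAt I x₀).map_target hy
  have h2 : y = extChartAt I x₀ ((extChartAt I x₀).symm y) :=
    ((extChartAt I x₀).right_inv hy).symm
  constructor
  · intro v w
    rw [h2, chartForm_eq I _ hp, chartForm_eq I _ hp]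
    exact k.symm _ _ _
  · intro v hv
    rw [h2, chartForm_eq I _ hp]
    exact k.pos _ _ fun h =>
      hv ((coordChangeEquiv I hp (mem_chart_source H _)).map_eq_zero_iff.1 h)

theorem volumeDensity_pos (x₀ : N) {y : EuclideanSpace ℝ (Fin d)}
    (hy : y ∈ (extChartAt I x₀).target) : 0 < volumeDensity I k.inner x₀ y :=
  Real.sqrt_pos.2 (det_gram_pos (chartForm_symm_pos I k x₀ hy).1 (chartForm_symm_pos I k x₀ hy).2)

set_option synthInstance.maxHeartbeats 400000 in
theorem continuousOn_volumeDensity (x₀ : N) :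
    ContinuousOn (volumeDensity I k.inner x₀) (extChartAt I x₀).target := by
  have h1 : ContinuousOn (fun y => familyForm I (fun _ => k.inner) x₀ ((0 : ℝ), y))
      (extChartAt I x₀).target :=
    ((isSmoothMetricFamily_const I k univ).contDiffOn_familyForm I x₀).continuousOn.comp
      (continuousOn_const.prodMk continuousOn_id) fun y hy => ⟨mem_univ _, hy⟩
  have h2 : Continuous fun b : EuclideanSpace ℝ (Fin d) →L[ℝ] EuclideanSpace ℝ (Fin d) →L[ℝ] ℝ =>
      √(Matrix.det (Matrix.of fun A B : Fin d =>
        b (EuclideanSpace.single A 1) (EuclideanSpace.single B 1))) := by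
    refine Real.continuous_sqrt.comp (Continuous.matrix_det ?_)
    refine continuous_matrix fun A B => ?_
    exact ((ContinuousLinearMap.apply ℝ ℝ (EuclideanSpace.single B (1 : ℝ))) ∘L
      (ContinuousLinearMap.apply ℝ (EuclideanSpace ℝ (Fin d) →L[ℝ] ℝ)
        (EuclideanSpace.single A (1 : ℝ)))).continuous
  exact h2.comp_continuousOn h1

variable [MeasurableSpace N] [BorelSpace N]

theorem riemannianVolume_apply (x₀ : N) {s : Set N} (hs : MeasurableSet s)
    (h : s ⊆ (chartAt H x₀).source) :
    riemannianVolume I k.inner s = ∫⁻ y in (extChartAt I x₀).symm ⁻¹' s ∩ (extChartAt I x₀).target,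
      ENNReal.ofReal (volumeDensity I k.inner x₀ y) := by
  rw [← chartVolume_apply I k.inner x₀ hs, ← riemannianVolume_restrict_source,
    Measure.restrict_apply hs, inter_eq_left.2 h]

/-- By compactness local finiteness suffices: near a point the density is bounded by continuity, and
the coordinates range in a unit ball. -/
theorem isFiniteMeasure_riemannianVolume [CompactSpace N] :
    IsFiniteMeasure (riemannianVolume I k.inner) := by
  refine ⟨isCompact_univ.measure_lt_top_of_nhdsWithin fun x _ => ?_⟩
  rw [nhdsWithin_univ]
  set y := extChartAt I x x
  have hev : ∀ᶠ z in 𝓝[(extChartAt I x).target] y,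
      volumeDensity I k.inner x z < volumeDensity I k.inner x y + 1 :=
    (continuousOn_volumeDensity I k x y (mem_extChartAt_target x)).eventually_lt_const
      (lt_add_one _)
  obtain ⟨O, hO, hyO, hsub⟩ := mem_nhdsWithin.1 hev
  have hO' : IsOpen (O ∩ Metric.ball y 1) := hO.inter Metric.isOpen_ball
  have hs : IsOpen ((chartAt H x).source ∩ extChartAt I x ⁻¹' (O ∩ Metric.ball y 1)) := by
    have := (continuousOn_extChartAt (I := I) x).isOpen_inter_preimage
      (isOpen_extChartAt_source x) hO'
    rwa [extChartAt_source] at this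
  refine ⟨_, hs.mem_nhds ⟨mem_chart_source H x, hyO, Metric.mem_ball_self one_pos⟩, ?_⟩
  rw [riemannianVolume_apply I k x hs.measurableSet inter_subset_left]
  set A := (extChartAt I x).symm ⁻¹' ((chartAt H x).source ∩
    extChartAt I x ⁻¹' (O ∩ Metric.ball y 1)) ∩ (extChartAt I x).target
  have hA : ∀ z ∈ A, z ∈ O ∩ Metric.ball y 1 := by
    rintro z ⟨⟨-, hz⟩, hzt⟩
    rwa [mem_preimage, (extChartAt I x).right_inv hzt] at hz
  calc ∫⁻ z in A, ENNReal.ofReal (volumeDensity I k.inner x z)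
      ≤ ∫⁻ _ in A, ENNReal.ofReal (volumeDensity I k.inner x y + 1) := by
        refine setLIntegral_mono measurable_const fun z hz => ENNReal.ofReal_le_ofReal ?_
        exact le_of_lt (hsub ⟨(hA z hz).1, hz.2⟩)
    _ = ENNReal.ofReal (volumeDensity I k.inner x y + 1) * volume A := setLIntegral_const _ _
    _ < ⊤ := ENNReal.mul_lt_top ENNReal.ofReal_lt_top
        ((measure_mono fun z hz => (hA z hz).2).trans_lt measure_ball_lt_top)

theorem isOpenPosMeasure_riemannianVolume :
    (riemannianVolume I k.inner).IsOpenPosMeasure := by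
  refine ⟨fun U hU ⟨x, hx⟩ h0 => ?_⟩
  have hs : IsOpen (U ∩ (chartAt H x).source) := hU.inter (chartAt H x).open_source
  have h1 : riemannianVolume I k.inner (U ∩ (chartAt H x).source) = 0 :=
    measure_mono_null inter_subset_left h0
  rw [riemannianVolume_apply I k x hs.measurableSet inter_subset_right] at h1
  set T := (extChartAt I x).target
  set A := (extChartAt I x).symm ⁻¹' (U ∩ (chartAt H x).source) ∩ T with hA
  have hyT : extChartAt I x x ∈ T := mem_extChartAt_target x
  have hAnhds : A ∈ 𝓝[T] (extChartAt I x x) := by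
    refine inter_mem ?_ self_mem_nhdsWithin
    refine (continuousOn_extChartAt_symm x _ hyT).preimage_mem_nhdsWithin ?_
    rw [extChartAt_to_inv]
    exact hs.mem_nhds ⟨hx, mem_chart_source H x⟩
  obtain ⟨O, hO, hyO, hsub⟩ := mem_nhdsWithin.1 hAnhds
  -- If `x` is a boundary point, `A` need not be a neighbourhood in the Euclidean space. The chart
  -- target lies in the closure of its interior, so `A` still contains a nonempty open set.
  obtain ⟨z, hzO, hzT⟩ := mem_closure_iff.1
    (extChartAt_target_subset_closure_interior hyT) O hO hyO
  have hW : IsOpen (O ∩ interior T) := hO.inter isOpen_interior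
  have hWA : O ∩ interior T ⊆ A := fun w hw => hsub ⟨hw.1, interior_subset hw.2⟩
  have h2 : ∫⁻ w in O ∩ interior T, ENNReal.ofReal (volumeDensity I k.inner x w) = 0 :=
    le_antisymm ((lintegral_mono_set hWA).trans h1.le) zero_le
  have hmeas : AEMeasurable (fun w => ENNReal.ofReal (volumeDensity I k.inner x w))
      (volume.restrict (O ∩ interior T)) :=
    (((continuousOn_volumeDensity I k x).mono
      (inter_subset_right.trans interior_subset)).aemeasurable hW.measurableSet).ennreal_ofReal
  rw [lintegral_eq_zero_iff' hmeas] at h2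
  have h3 : ∀ᵐ w ∂(volume.restrict (O ∩ interior T)), False := by
    filter_upwards [h2, ae_restrict_mem hW.measurableSet] with w hw hwW
    have := volumeDensity_pos I k x (interior_subset hwW.2)
    simp only [Pi.zero_apply, ENNReal.ofReal_eq_zero] at hw
    linarith
  rw [eventually_false_iff_eq_bot, ae_eq_bot, Measure.restrict_eq_zero] at h3
  exact (hW.measure_pos volume ⟨z, hzO, hzT⟩).ne' h3

end VolumeProperties

/-! ### Integrating a derivative over a product. -/

section Monotonicity

variable {X : Type*} [MeasurableSpace X] {μ : Measure X} [IsFiniteMeasure μ]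
  {a b : ℝ} {m : ℝ → X → ℝ} {f q : ℝ × X → ℝ}

theorem setIntegral_add_eq_integral_sub
    (hm : ∀ r ∈ Ioo a b, Integrable (m r) μ)
    (hder : ∀ r ∈ Ioo a b, ∀ x, HasDerivAt (fun t => m t x) (f (r, x) + q (r, x)) r)
    (hf : IntegrableOn f (Ioo a b ×ˢ univ) ((volume : Measure ℝ).prod μ))
    {c e : ℝ} (hac : a < c) (hce : c ≤ e) (heb : e < b)
    (hq : IntegrableOn q (Icc c e ×ˢ univ) ((volume : Measure ℝ).prod μ)) :
    ((∫ p in Ioc c e ×ˢ univ, f p ∂((volume : Measure ℝ).prod μ))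
      + ∫ p in Ioc c e ×ˢ univ, q p ∂((volume : Measure ℝ).prod μ))
      = ∫ x, m e x ∂μ - ∫ x, m c x ∂μ := by
  have hsub : Icc c e ⊆ Ioo a b := fun t ht => ⟨hac.trans_le ht.1, ht.2.trans_lt heb⟩
  have hf' := hf.mono_set (prod_mono (Ioc_subset_Icc_self.trans hsub) (subset_refl (univ : Set X)))
  have hq' := hq.mono_set (prod_mono Ioc_subset_Icc_self (subset_refl (univ : Set X)))
  rw [← integral_add hf' hq', ← integral_sub (hm e (hsub (right_mem_Icc.2 hce)))
    (hm c (hsub (left_mem_Icc.2 hce)))]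
  have hint : Integrable (fun p => f p + q p)
      (((volume : Measure ℝ).restrict (Ioc c e)).prod μ) := by
    have : IntegrableOn (fun p => f p + q p) _ _ := hf'.add hq'
    rwa [IntegrableOn, ← Measure.prod_restrict, Measure.restrict_univ] at this
  rw [← Measure.prod_restrict, Measure.restrict_univ, integral_prod_symm _ hint]
  refine integral_congr_ae ?_
  -- The derivative is not assumed continuous; Fubini supplies, for almost every `x`, the
  -- integrability in `r` that the fundamental theorem of calculus requires.
  filter_upwards [hint.prod_left_ae] with x hx
  rw [← intervalIntegral.integral_of_le hce]
  refine intervalIntegral.integral_eq_sub_of_hasDerivAt (f := fun t => m t x) ?_ ?_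
  · intro t ht
    rw [uIcc_of_le hce] at ht
    exact hder t (hsub ht) x
  · rwa [intervalIntegrable_iff_integrableOn_Ioc_of_le hce]

/-- A function whose derivative is `f + q` with `q ≥ 0`: the increment of its integral between
the ends of the interval exceeds the integral of `f` by the integral of `q`. -/
theorem exists_tendsto_setIntegral (hab : a < b)
    (hm : ∀ r ∈ Ioo a b, Integrable (m r) μ)
    (hder : ∀ r ∈ Ioo a b, ∀ x, HasDerivAt (fun t => m t x) (f (r, x) + q (r, x)) r)
    (hf : IntegrableOn f (Ioo a b ×ˢ univ) ((volume : Measure ℝ).prod μ))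
    (hq : ∀ c e, a < c → e < b →
      IntegrableOn q (Icc c e ×ˢ univ) ((volume : Measure ℝ).prod μ))
    {A B : ℝ} (hA : Tendsto (fun r => ∫ x, m r x ∂μ) (𝓝[>] a) (𝓝 A))
    (hB : Tendsto (fun r => ∫ x, m r x ∂μ) (𝓝[<] b) (𝓝 B)) :
    ∃ u v : ℕ → ℝ, (∀ n, a < u n ∧ u n < v n ∧ v n < b) ∧ Tendsto u atTop (𝓝 a) ∧
      Tendsto v atTop (𝓝 b) ∧
      Tendsto (fun n => ∫ p in Ioc (u n) (v n) ×ˢ univ, q p ∂((volume : Measure ℝ).prod μ)) atTop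
        (𝓝 (B - A - ∫ p in Ioo a b ×ˢ univ, f p ∂((volume : Measure ℝ).prod μ))) := by
  obtain ⟨c, hac, hcb⟩ := exists_between hab
  obtain ⟨u, hu_anti, hu, hu_lim⟩ := exists_seq_strictAnti_tendsto' hac
  obtain ⟨v, hv_mono, hv, hv_lim⟩ := exists_seq_strictMono_tendsto' hcb
  have huv (n : ℕ) : u n < v n := (hu n).2.trans (hv n).1
  refine ⟨u, v, fun n => ⟨(hu n).1, huv n, (hv n).2⟩, hu_lim, hv_lim, ?_⟩
  have hunion : ⋃ n, Ioc (u n) (v n) ×ˢ (univ : Set X) = Ioo a b ×ˢ univ := by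
    ext ⟨r, x⟩
    simp only [mem_iUnion, mem_prod, mem_univ, and_true, mem_Ioc, mem_Ioo]
    constructor
    · rintro ⟨n, h1, h2⟩
      exact ⟨(hu n).1.trans h1, h2.trans_lt (hv n).2⟩
    · rintro ⟨h1, h2⟩
      obtain ⟨n, h3, h4⟩ := ((hu_lim.eventually (eventually_lt_nhds h1)).and
        (hv_lim.eventually (eventually_gt_nhds h2))).exists
      exact ⟨n, h3, h4.le⟩
  have hF : Tendsto
      (fun n => ∫ p in Ioc (u n) (v n) ×ˢ univ, f p ∂((volume : Measure ℝ).prod μ)) atTop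
      (𝓝 (∫ p in Ioo a b ×ˢ univ, f p ∂((volume : Measure ℝ).prod μ))) := by
    rw [← hunion] at hf ⊢
    refine tendsto_setIntegral_of_monotone
      (fun n => measurableSet_Ioc.prod MeasurableSet.univ) ?_ hf
    intro i j hij
    exact prod_mono (Ioc_subset_Ioc (hu_anti.antitone hij) (hv_mono.monotone hij)) subset_rfl
  have hMu : Tendsto (fun n => ∫ x, m (u n) x ∂μ) atTop (𝓝 A) :=
    hA.comp (tendsto_nhdsWithin_iff.2 ⟨hu_lim, Eventually.of_forall fun n => (hu n).1⟩)
  have hMv : Tendsto (fun n => ∫ x, m (v n) x ∂μ) atTop (𝓝 B) :=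
    hB.comp (tendsto_nhdsWithin_iff.2 ⟨hv_lim, Eventually.of_forall fun n => (hv n).2⟩)
  -- Integrability of `q` up to the ends is not assumed; its integrals converge because the other
  -- three terms of the identity do.
  refine ((hMv.sub hMu).sub hF).congr fun n => ?_
  rw [← setIntegral_add_eq_integral_sub hm hder hf (hu n).1 (huv n).le (hv n).2
    (hq _ _ (hu n).1 (hv n).2)]
  ring

omit [IsFiniteMeasure μ] in
-- The exhausting rectangles eventually contain the given one, and `q` is nonnegative. With `D = 0`
-- this makes `q` vanish almost everywhere on each rectangle.
theorem setIntegral_le_of_tendsto (hq : ∀ c e, a < c → e < b →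
      IntegrableOn q (Icc c e ×ˢ univ) ((volume : Measure ℝ).prod μ))
    (hpos : ∀ r ∈ Ioo a b, ∀ x, 0 ≤ q (r, x)) {u v : ℕ → ℝ}
    (huv : ∀ n, a < u n ∧ u n < v n ∧ v n < b) (hu : Tendsto u atTop (𝓝 a))
    (hv : Tendsto v atTop (𝓝 b)) {D : ℝ}
    (hD : Tendsto (fun n => ∫ p in Ioc (u n) (v n) ×ˢ univ, q p ∂((volume : Measure ℝ).prod μ))
      atTop (𝓝 D)) {c e : ℝ} (hac : a < c) (heb : e < b) :
    ∫ p in Ioc c e ×ˢ univ, q p ∂((volume : Measure ℝ).prod μ) ≤ D := by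
  refine ge_of_tendsto hD ?_
  filter_upwards [hu.eventually (eventually_lt_nhds hac),
    hv.eventually (eventually_gt_nhds heb)] with n h1 h2
  refine setIntegral_mono_set ((hq _ _ (huv n).1 (huv n).2.2).mono_set
    (prod_mono Ioc_subset_Icc_self subset_rfl)) ?_
    (Eventually.of_forall (prod_mono (Ioc_subset_Ioc h1.le h2.le) subset_rfl))
  filter_upwards [ae_restrict_mem (measurableSet_Ioc.prod MeasurableSet.univ)] with p hp
  exact hpos p.1 ⟨(huv n).1.trans hp.1.1, hp.1.2.trans_lt (huv n).2.2⟩ p.2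

end Monotonicity

/-! ### Smooth multiples of sections. -/

section Bundles

variable {E : Type*} [NormedAddCommGroup E] [NormedSpace ℝ E] {H : Type*} [TopologicalSpace H]
  {I : ModelWithCorners ℝ E H} {B : Type*} [TopologicalSpace B] [ChartedSpace H B]
  {E' : Type*} [NormedAddCommGroup E'] [NormedSpace ℝ E'] {H' : Type*} [TopologicalSpace H']
  {I' : ModelWithCorners ℝ E' H'} {M : Type*} [TopologicalSpace M] [ChartedSpace H' M]
  {F : Type*} [NormedAddCommGroup F] [NormedSpace ℝ F]
  {V : B → Type*} [TopologicalSpace (TotalSpace F V)] [∀ x, TopologicalSpace (V x)]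
  [FiberBundle F V] [∀ x, AddCommGroup (V x)] [∀ x, Module ℝ (V x)] [VectorBundle ℝ F V]

/-- A smooth multiple of a smooth section along a map is smooth. -/
theorem contMDiffWithinAt_smul_mk' {n : ℕ∞ω} {b : M → B} {s : ∀ m, V (b m)} {f : M → ℝ}
    {u : Set M} {m : M} (hf : ContMDiffWithinAt I' 𝓘(ℝ, ℝ) n f u m)
    (hs : ContMDiffWithinAt I' (I.prod 𝓘(ℝ, F)) n (fun m => TotalSpace.mk' F (b m) (s m)) u m) :
    ContMDiffWithinAt I' (I.prod 𝓘(ℝ, F)) n (fun m => TotalSpace.mk' F (b m) (f m • s m)) u m := by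
  rw [contMDiffWithinAt_totalSpace] at hs ⊢
  set e := trivializationAt F V (b m) with he
  refine ⟨hs.1, (hf.smul hs.2).congr_of_eventuallyEq ?_ ?_⟩
  · filter_upwards [hs.1.continuousWithinAt.preimage_mem_nhdsWithin
      (e.open_baseSet.mem_nhds (mem_baseSet_trivializationAt F V (b m)))] with q hq
    exact (e.linear ℝ hq).2 (f q) (s q)
  · exact (e.linear ℝ (mem_baseSet_trivializationAt F V (b m))).2 (f m) (s m)

end Bundles

/-! ### Comparison with the spherical model. -/

section Comparison

variable {d : ℕ} {H : Type*} [TopologicalSpace H]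
  (I : ModelWithCorners ℝ (EuclideanSpace ℝ (Fin d)) H)
  {N : Type*} [TopologicalSpace N] [ChartedSpace H N] [IsManifold I ∞ N]

theorem isSmoothMetricFamily_warped
    (k : ContMDiffRiemannianMetric I ∞ (EuclideanSpace ℝ (Fin d)) (fun x : N => TangentSpace I x))
    {J : Set ℝ} {h : ℝ → ℝ} (hh : ContDiffOn ℝ ∞ h J) (h0 : ∀ r ∈ J, h r ≠ 0) :
    IsSmoothMetricFamily I J (warped I h k.inner) where
  symm r _ x v w := congrArg (h r ^ 2 * ·) (k.symm x v w)
  pos r hr x v hv := mul_pos (sq_pos_iff.2 (h0 r hr)) (k.pos x v hv)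
  contMDiffOn := by
    intro p hp
    have h1 := (isSmoothMetricFamily_const I k J).contMDiffOn p hp
    have h2 : ContMDiffWithinAt (𝓘(ℝ, ℝ).prod I) 𝓘(ℝ, ℝ) ∞ (fun p : ℝ × N => h p.1 ^ 2)
        (J ×ˢ univ) p :=
      (((hh.pow 2).contMDiffOn).comp contMDiffOn_fst fun q hq => hq.1) p hp
    exact contMDiffWithinAt_smul_mk' h2 h1

theorem form_smul_apply (b : EuclideanSpace ℝ (Fin d) →L[ℝ] EuclideanSpace ℝ (Fin d) →L[ℝ] ℝ)
    (c : ℝ) (v w : EuclideanSpace ℝ (Fin d)) : b (c • v) w = c * b v w := by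
  simp

theorem trace_sq_smul_one_sub (W : EuclideanSpace ℝ (Fin d) →L[ℝ] EuclideanSpace ℝ (Fin d))
    (α β : ℝ) :
    traceCLM d ((α • ContinuousLinearMap.id ℝ _ - β • W) ∘L
        (α • ContinuousLinearMap.id ℝ _ - β • W))
      = d * α ^ 2 - 2 * α * β * traceCLM d W + β ^ 2 * traceCLM d (W ∘L W) := by
  have h1 : (α • ContinuousLinearMap.id ℝ (EuclideanSpace ℝ (Fin d)) - β • W) ∘L
      (α • ContinuousLinearMap.id ℝ _ - β • W)
      = α ^ 2 • ContinuousLinearMap.id ℝ _ - (2 * α * β) • W + β ^ 2 • (W ∘L W) := by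
    ext1 v
    simp only [ContinuousLinearMap.comp_apply, sub_apply, add_apply, smul_apply,
      ContinuousLinearMap.id_apply, map_sub, map_smul]
    module
  have h2 : traceCLM d (ContinuousLinearMap.id ℝ (EuclideanSpace ℝ (Fin d))) = d := by
    rw [traceCLM_apply, trace_eq_sum]
    simp
  rw [h1, map_add, map_sub, map_smul, map_smul, map_smul, h2]
  simp only [smul_eq_mul]
  ring

/-- The square `|sin(r) W - cos(r)|²` which measures the failure of `dr² + G(r)` to be a spherical
cone. -/
def umbilicDefect (G : ℝ → ∀ x : N, TangentSpace I x →L[ℝ] TangentSpace I x →L[ℝ] ℝ)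
    (p : ℝ × N) : ℝ :=
  d * Real.cos p.1 ^ 2 - 2 * Real.cos p.1 * Real.sin p.1 * traceCLM d (shape I G p.1 p.2)
    + Real.sin p.1 ^ 2 * traceCLM d (shape I G p.1 p.2 ∘L shape I G p.1 p.2)

variable {G : ℝ → ∀ x : N, TangentSpace I x →L[ℝ] TangentSpace I x →L[ℝ] ℝ}

omit [IsManifold I ∞ N] in
theorem umbilicDefect_eq (r : ℝ) (x : N) :
    umbilicDefect I G (r, x) = LinearMap.trace ℝ (EuclideanSpace ℝ (Fin d))
      ((Real.cos r • ContinuousLinearMap.id ℝ _ - Real.sin r • shape I G r x) ∘L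
        (Real.cos r • ContinuousLinearMap.id ℝ _ - Real.sin r • shape I G r x) :
          EuclideanSpace ℝ (Fin d) →L[ℝ] EuclideanSpace ℝ (Fin d)) := by
  rw [← traceCLM_apply, trace_sq_smul_one_sub]
  rfl

/-- Half the logarithmic derivative of `h²` is `h' / h`. Only the fibre over `x` enters, so the
warped form is required at this one point only. -/
theorem IsSmoothMetricFamily.shape_warped {J : Set ℝ} (hG : IsSmoothMetricFamily I J G)
    (hJ : IsOpen J) {r : ℝ} (hr : r ∈ J)
    {x : N} {B : TangentSpace I x →L[ℝ] TangentSpace I x →L[ℝ] ℝ} {h : ℝ → ℝ} {h' : ℝ}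
    (hB : ∀ t ∈ J, G t x = h t ^ 2 • B) (hh : HasDerivAt h h' r) :
    shape I G r x = (h' / h r) • ContinuousLinearMap.id ℝ _ := by
  ext1 v
  refine hG.eq_of_forall_apply_eq I hr x fun w => ?_
  have h1 := hG.hasDerivAt_apply I hJ hr x v w
  have h2 : HasDerivAt (fun t => G t x v w) (2 * h r * h' * B v w) r := by
    have h3 : HasDerivAt (fun t => h t ^ 2 * B v w) (2 * h r * h' * B v w) r := by
      simpa using (hh.pow 2).mul_const (B v w)
    refine h3.congr_of_eventuallyEq ?_
    filter_upwards [hJ.mem_nhds hr] with t ht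
    rw [hB t ht]
    rfl
  have h4 := h1.unique h2
  have h5 : G r x ((h' / h r) • v : EuclideanSpace ℝ (Fin d)) w = (h' / h r) * G r x v w :=
    form_smul_apply (G r x) _ v w
  have h6 : G r x v w = h r ^ 2 * B v w := by
    rw [hB r hr]
    rfl
  refine Eq.trans ?_ h5.symm
  rw [h6]
  field_simp
  linarith

section Sphere

theorem sin_ne_zero_of_mem {r : ℝ} (hr : r ∈ Ioo 0 Real.pi) : Real.sin r ≠ 0 :=
  (Real.sin_pos_of_mem_Ioo hr).ne'

theorem meanCurvature_warped_sin
    (k : ContMDiffRiemannianMetric I ∞ (EuclideanSpace ℝ (Fin d)) (fun x : N => TangentSpace I x))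
    {r : ℝ} (hr : r ∈ Ioo 0 Real.pi) (x : N) :
    meanCurvature I (warped I Real.sin k.inner) r x = d * (Real.cos r / Real.sin r) := by
  have hw := isSmoothMetricFamily_warped I k Real.contDiff_sin.contDiffOn
    fun t ht => sin_ne_zero_of_mem (r := t) ht
  rw [hw.meanCurvature_eq I isOpen_Ioo hr, hw.shape_warped I isOpen_Ioo hr (B := k.inner x)
    (fun _ _ => rfl) (Real.hasDerivAt_sin r), map_smul, traceCLM_apply,
    trace_eq_sum]
  simp [mul_comm]

variable (hG : IsSmoothMetricFamily I (Ioo 0 Real.pi) G)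
include hG

theorem mass_eq
    (k : ContMDiffRiemannianMetric I ∞ (EuclideanSpace ℝ (Fin d)) (fun x : N => TangentSpace I x))
    {r : ℝ} (hr : r ∈ Ioo 0 Real.pi) (x : N) :
    mass I Real.sin k.inner G r x
      = d * (Real.sin r * Real.cos r) - Real.sin r ^ 2 * traceCLM d (shape I G r x) := by
  rw [mass, meanCurvature_warped_sin I k hr, hG.meanCurvature_eq I isOpen_Ioo hr]
  have := sin_ne_zero_of_mem hr
  field_simp

/-- The derivative of `d sin cos` is `d cos² - d sin²`. The second term completes the Ricci term of
the Riccati equation to `(R_rr - d) sin²`; the first completes the terms in `tr W` and `tr W²` to a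
square. -/
theorem hasDerivAt_mass
    (k : ContMDiffRiemannianMetric I ∞ (EuclideanSpace ℝ (Fin d)) (fun x : N => TangentSpace I x))
    {r : ℝ} (hr : r ∈ Ioo 0 Real.pi) (x : N) :
    HasDerivAt (fun t => mass I Real.sin k.inner G t x)
      ((ricciRadial I G r x - d) * Real.sin r ^ 2 + umbilicDefect I G (r, x)) r := by
  have h1 := (((Real.hasDerivAt_sin r).mul (Real.hasDerivAt_cos r)).const_mul (d : ℝ)).sub
    (((Real.hasDerivAt_sin r).pow 2).mul (hG.hasDerivAt_trace_shape I isOpen_Ioo hr x))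
  refine (h1.congr_deriv ?_).congr_of_eventuallyEq ?_
  · simp only [umbilicDefect, Pi.pow_apply]
    ring
  · filter_upwards [isOpen_Ioo.mem_nhds hr] with t ht
    exact mass_eq I hG k ht x

theorem defect_self_adjoint {r : ℝ} (hr : r ∈ Ioo 0 Real.pi) (x : N)
    (v w : EuclideanSpace ℝ (Fin d)) :
    G r x ((Real.cos r • ContinuousLinearMap.id ℝ (EuclideanSpace ℝ (Fin d))
        - Real.sin r • shape I G r x) v) w
      = G r x v ((Real.cos r • ContinuousLinearMap.id ℝ (EuclideanSpace ℝ (Fin d))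
        - Real.sin r • shape I G r x) w) := by
  have key (B : EuclideanSpace ℝ (Fin d) →L[ℝ] EuclideanSpace ℝ (Fin d) →L[ℝ] ℝ)
      (hB : B (shape I G r x v) w = B v (shape I G r x w)) :
      B ((Real.cos r • ContinuousLinearMap.id ℝ (EuclideanSpace ℝ (Fin d))
        - Real.sin r • shape I G r x) v) w
      = B v ((Real.cos r • ContinuousLinearMap.id ℝ (EuclideanSpace ℝ (Fin d))
        - Real.sin r • shape I G r x) w) := by
    simp [hB]
  exact key (G r x) (hG.shape_self_adjoint I isOpen_Ioo hr x v w)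

theorem umbilicDefect_nonneg {r : ℝ} (hr : r ∈ Ioo 0 Real.pi) (x : N) :
    0 ≤ umbilicDefect I G (r, x) := by
  rw [umbilicDefect_eq I]
  exact trace_sq_nonneg (E := EuclideanSpace ℝ (Fin d)) (b := G r x) (hG.symm r hr x)
    (hG.pos r hr x) (defect_self_adjoint I hG hr x)

theorem shape_eq_of_umbilicDefect_eq_zero {r : ℝ} (hr : r ∈ Ioo 0 Real.pi) {x : N}
    (h : umbilicDefect I G (r, x) = 0) :
    shape I G r x = (Real.cos r / Real.sin r) • ContinuousLinearMap.id ℝ _ := by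
  rw [umbilicDefect_eq I] at h
  have h1 := eq_zero_of_trace_sq (E := EuclideanSpace ℝ (Fin d)) (b := G r x) (hG.symm r hr x)
    (hG.pos r hr x) (defect_self_adjoint I hG hr x) h
  rw [div_eq_inv_mul, mul_smul, sub_eq_zero.1 h1, inv_smul_smul₀ (sin_ne_zero_of_mem hr)]

theorem umbilicDefect_eq_zero_of_warped {r : ℝ} (hr : r ∈ Ioo 0 Real.pi) {x : N}
    {B : TangentSpace I x →L[ℝ] TangentSpace I x →L[ℝ] ℝ}
    (hB : ∀ t ∈ Ioo 0 Real.pi, G t x = Real.sin t ^ 2 • B) : umbilicDefect I G (r, x) = 0 := by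
  rw [umbilicDefect_eq I, hG.shape_warped I isOpen_Ioo hr hB
    (Real.hasDerivAt_sin r), smul_smul, mul_div_cancel₀ _ (sin_ne_zero_of_mem hr), sub_self]
  simp

/-- Here `W = cot r`, so every entry of `G / sin²` has zero derivative on the interval. Its constant
value is read off at `π / 2`, where `sin = 1`. -/
theorem eq_sin_sq_smul_of_umbilicDefect_eq_zero {x : N}
    (h : ∀ r ∈ Ioo 0 Real.pi, umbilicDefect I G (r, x) = 0) {r : ℝ} (hr : r ∈ Ioo 0 Real.pi) :
    G r x = Real.sin r ^ 2 • G (Real.pi / 2) x := by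
  have hmid : Real.pi / 2 ∈ Ioo 0 Real.pi := ⟨by positivity, by linarith [Real.pi_pos]⟩
  refine ContinuousLinearMap.ext fun v => ContinuousLinearMap.ext fun w => ?_
  have hder (t : ℝ) (ht : t ∈ Ioo 0 Real.pi) :
      HasDerivAt (fun t => G t x v w / Real.sin t ^ 2) 0 t := by
    have h1 := hG.hasDerivAt_apply I isOpen_Ioo ht x v w
    have h5 : G t x (shape I G t x v) w = (Real.cos t / Real.sin t) * G t x v w := by
      rw [shape_eq_of_umbilicDefect_eq_zero I hG ht (h t ht)]
      exact form_smul_apply (G t x) _ v w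
    have h0 := sin_ne_zero_of_mem ht
    refine (h1.div ((Real.hasDerivAt_sin t).pow 2) (pow_ne_zero 2 h0)).congr_deriv ?_
    rw [h5]
    simp only [Pi.pow_apply]
    field_simp
    ring
  have hconst : G r x v w / Real.sin r ^ 2
      = G (Real.pi / 2) x v w / Real.sin (Real.pi / 2) ^ 2 :=
    isOpen_Ioo.is_const_of_deriv_eq_zero isPreconnected_Ioo
      (fun t ht => (hder t ht).differentiableAt.differentiableWithinAt)
      (fun t ht => (hder t ht).deriv) hr hmid
  rw [Real.sin_pi_div_two, one_pow, div_one,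
    div_eq_iff (pow_ne_zero 2 (sin_ne_zero_of_mem hr))] at hconst
  rw [hconst, mul_comm]
  rfl

theorem continuousOn_umbilicDefect :
    ContinuousOn (umbilicDefect I G) (Ioo 0 Real.pi ×ˢ univ) := by
  have h1 := hG.continuousOn_trace_shape I isOpen_Ioo
  have h2 := hG.continuousOn_trace_shape_sq I isOpen_Ioo
  have hs : Continuous fun p : ℝ × N => Real.sin p.1 := Real.continuous_sin.comp continuous_fst
  have hc : Continuous fun p : ℝ × N => Real.cos p.1 := Real.continuous_cos.comp continuous_fst
  have h3 : Continuous fun p : ℝ × N => (d : ℝ) * Real.cos p.1 ^ 2 := by fun_prop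
  have h4 : Continuous fun p : ℝ × N => 2 * Real.cos p.1 * Real.sin p.1 := by fun_prop
  exact (h3.continuousOn.sub (h4.continuousOn.mul h1)).add ((hs.pow 2).continuousOn.mul h2)

theorem continuous_mass
    (k : ContMDiffRiemannianMetric I ∞ (EuclideanSpace ℝ (Fin d)) (fun x : N => TangentSpace I x))
    {r : ℝ} (hr : r ∈ Ioo 0 Real.pi) : Continuous (mass I Real.sin k.inner G r) := by
  have h1 : Continuous ((fun p : ℝ × N => traceCLM d (shape I G p.1 p.2)) ∘ fun x => (r, x)) :=
    (hG.continuousOn_trace_shape I isOpen_Ioo).comp_continuous (Continuous.prodMk_right r)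
      fun x => mk_mem_prod hr (mem_univ x)
  exact (continuous_const.sub (continuous_const.mul h1)).congr fun x => (mass_eq I hG k hr x).symm

end Sphere

end Comparison

/-- The minimum `c > 0` of `b v v` on the compact unit sphere gives `c ‖v‖² ≤ b v v`. A bundled
Riemannian metric carries this boundedness as a field. -/
theorem isVonNBounded_of_pos {E : Type*} [NormedAddCommGroup E] [NormedSpace ℝ E]
    [FiniteDimensional ℝ E] {b : E →L[ℝ] E →L[ℝ] ℝ} (hb : ∀ v, v ≠ 0 → 0 < b v v) :
    Bornology.IsVonNBounded ℝ {v : E | b v v < 1} := by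
  rw [NormedSpace.isVonNBounded_iff]
  have hcont : Continuous fun v => b v v := by fun_prop
  have hscale (v : E) (hv : v ≠ 0) : b (‖v‖⁻¹ • v) (‖v‖⁻¹ • v) = b v v / ‖v‖ ^ 2 := by
    simp only [map_smul, smul_apply, smul_eq_mul]
    field_simp
  have hmem (v : E) (hv : v ≠ 0) : ‖v‖⁻¹ • v ∈ Metric.sphere (0 : E) 1 := by
    simp [norm_smul, norm_ne_zero_iff.2 hv]
  have := FiniteDimensional.proper_real E
  rcases (Metric.sphere (0 : E) 1).eq_empty_or_nonempty with hS | hS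
  -- An empty unit sphere means that `E` is zero.
  · refine (Bornology.isBounded_singleton (x := (0 : E))).subset fun v _ => ?_
    by_contra hv
    exact hS.le (hmem v hv)
  · obtain ⟨z, hz, hmin⟩ := (isCompact_sphere (0 : E) 1).exists_isMinOn hS hcont.continuousOn
    have hz0 : z ≠ 0 := by
      rintro rfl
      simp at hz
    have hc := hb z hz0
    refine (Metric.isBounded_closedBall (x := (0 : E)) (r := √(b z z)⁻¹)).subset fun v hv => ?_
    rw [mem_closedBall_zero_iff]
    refine Real.le_sqrt_of_sq_le ?_
    by_cases hv0 : v = 0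
    · simp [hv0, hc.le]
    have h1 : b z z ≤ b v v / ‖v‖ ^ 2 := by
      rw [← hscale v hv0]
      exact hmin (hmem v hv0)
    have h2 : 0 < ‖v‖ ^ 2 := by positivity
    rw [le_div_iff₀ h2] at h1
    rw [le_inv_comm₀ h2 hc, ← one_div, le_div_iff₀ h2]
    exact h1.trans (le_of_lt hv)

/-! ### Rigidity and the integrated inequality. -/

section Rigidity

variable {d : ℕ} {H : Type*} [TopologicalSpace H]
  (I : ModelWithCorners ℝ (EuclideanSpace ℝ (Fin d)) H)
  {N : Type*} [TopologicalSpace N] [ChartedSpace H N] [IsManifold I ∞ N]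
  {G : ℝ → ∀ x : N, TangentSpace I x →L[ℝ] TangentSpace I x →L[ℝ] ℝ}

/-- A member of a smooth family of metrics is a smooth metric. -/
def IsSmoothMetricFamily.metricAt {J : Set ℝ} (hG : IsSmoothMetricFamily I J G) {r : ℝ}
    (hr : r ∈ J) :
    ContMDiffRiemannianMetric I ∞ (EuclideanSpace ℝ (Fin d)) (fun x : N => TangentSpace I x) where
  inner := G r
  symm := hG.symm r hr
  pos := hG.pos r hr
  isVonNBounded x := isVonNBounded_of_pos (E := EuclideanSpace ℝ (Fin d)) (hG.pos r hr x)
  contMDiff := hG.contMDiffOn.comp_contMDiff (contMDiff_const.prodMk contMDiff_id)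
    fun x => ⟨hr, mem_univ x⟩

omit [IsManifold I ∞ N] in
-- Both sides of the asymptotic estimate scale by `h r ^ 2`, which cancels even where `h` tends to
-- zero. What remains is independent of `r`, so for each `ε` a single `r ∈ J` near `r₀` suffices.
theorem eq_of_isAsymptoticAt {k k' : ∀ x : N, TangentSpace I x →L[ℝ] TangentSpace I x →L[ℝ] ℝ}
    {J : Set ℝ} {h : ℝ → ℝ} (h0 : ∀ r ∈ J, h r ≠ 0)
    (hG : ∀ r ∈ J, ∀ x, G r x = h r ^ 2 • k' x) {r₀ : ℝ} (hr₀ : r₀ ∈ closure J)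
    (hasym : IsAsymptoticAt I J G (warped I h k) r₀) (x : N) : k' x = k x := by
  have := mem_closure_iff_nhdsWithin_neBot.1 hr₀
  refine ContinuousLinearMap.ext fun v => ContinuousLinearMap.ext fun w => ?_
  have hle (ε : ℝ) (hε : 0 < ε) : |k' x v w - k x v w| ≤ ε * (√(k x v v) * √(k x w w)) := by
    obtain ⟨r, hr, hrJ⟩ := ((hasym ε hε).and self_mem_nhdsWithin).exists
    have h1 := hr x v w
    have hpos : 0 < h r ^ 2 := sq_pos_iff.2 (h0 r hrJ)
    have h2 : G r x v w = h r ^ 2 * k' x v w := by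
      rw [hG r hrJ x]
      rfl
    have h3 (a b : TangentSpace I x) : warped I h k r x a b = h r ^ 2 * k x a b := rfl
    rw [h2, h3, h3, h3, ← mul_sub, abs_mul, abs_of_pos hpos, Real.sqrt_mul hpos.le,
      Real.sqrt_mul hpos.le] at h1
    have h4 : √(h r ^ 2) * √(k x v v) * (√(h r ^ 2) * √(k x w w))
        = h r ^ 2 * (√(k x v v) * √(k x w w)) := by
      rw [mul_mul_mul_comm, Real.mul_self_sqrt hpos.le]
    rw [h4, mul_left_comm] at h1
    exact le_of_mul_le_mul_left h1 hpos
  have hlim : Tendsto (fun ε : ℝ => ε * (√(k x v v) * √(k x w w))) (𝓝[>] 0) (𝓝 0) := by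
    have : Tendsto (fun ε : ℝ => ε * (√(k x v v) * √(k x w w))) (𝓝 0)
        (𝓝 (0 * (√(k x v v) * √(k x w w)))) := tendsto_id.mul_const _
    rw [zero_mul] at this
    exact this.mono_left nhdsWithin_le_nhds
  have hzero : |k' x v w - k x v w| ≤ 0 :=
    ge_of_tendsto hlim (eventually_mem_nhdsWithin.mono fun ε hε => hle ε hε)
  exact sub_eq_zero.1 (abs_nonpos_iff.1 hzero)

variable [CompactSpace N] [T2Space N] [MeasurableSpace N] [BorelSpace N]

/-- The total mass increases at least by the curvature integral, with equality exactly if all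
level sets are umbilic with the Weingarten map of the model. -/
theorem integral_le_totalMass_sub
    (k : ContMDiffRiemannianMetric I ∞ (EuclideanSpace ℝ (Fin d)) (fun x : N => TangentSpace I x))
    (hG : IsSmoothMetricFamily I (Ioo 0 Real.pi) G) {M₀ M₁ : ℝ}
    (hM₀ : Tendsto (totalMass I Real.sin k.inner G) (𝓝[>] 0) (𝓝 M₀))
    (hM₁ : Tendsto (totalMass I Real.sin k.inner G) (𝓝[<] Real.pi) (𝓝 M₁))
    (hint : IntegrableOn (fun p : ℝ × N => (ricciRadial I G p.1 p.2 - d) * Real.sin p.1 ^ 2)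
      (Ioo 0 Real.pi ×ˢ univ) ((volume : Measure ℝ).prod (riemannianVolume I k.inner))) :
    (∫ p in Ioo 0 Real.pi ×ˢ univ, (ricciRadial I G p.1 p.2 - d) * Real.sin p.1 ^ 2
        ∂((volume : Measure ℝ).prod (riemannianVolume I k.inner))) ≤ M₁ - M₀ ∧
    (M₁ - M₀ = (∫ p in Ioo 0 Real.pi ×ˢ univ, (ricciRadial I G p.1 p.2 - d) * Real.sin p.1 ^ 2
        ∂((volume : Measure ℝ).prod (riemannianVolume I k.inner))) ↔
      ∀ r ∈ Ioo 0 Real.pi, ∀ x, umbilicDefect I G (r, x) = 0) := by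
  have hfin := isFiniteMeasure_riemannianVolume I k
  have hpos := isOpenPosMeasure_riemannianVolume I k
  set μ := riemannianVolume I k.inner
  have hq : ∀ c e, 0 < c → e < Real.pi →
      IntegrableOn (umbilicDefect I G) (Icc c e ×ˢ univ) ((volume : Measure ℝ).prod μ) := by
    intro c e hc he
    refine ((continuousOn_umbilicDefect I hG).mono ?_).integrableOn_compact
      (isCompact_Icc.prod isCompact_univ)
    exact prod_mono (fun t ht => ⟨hc.trans_le ht.1, ht.2.trans_lt he⟩) subset_rfl
  have hnonneg : ∀ r ∈ Ioo 0 Real.pi, ∀ x, 0 ≤ umbilicDefect I G (r, x) :=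
    fun r hr x => umbilicDefect_nonneg I hG hr x
  have hm : ∀ r ∈ Ioo 0 Real.pi, Integrable (mass I Real.sin k.inner G r) μ := by
    intro r hr
    rw [← integrableOn_univ]
    exact (continuous_mass I hG k hr).continuousOn.integrableOn_compact isCompact_univ
  obtain ⟨u, v, huv, hu, hv, hlim⟩ := exists_tendsto_setIntegral Real.pi_pos hm
    (fun r hr x => hasDerivAt_mass I hG k hr x) hint hq hM₀ hM₁
  set D := M₁ - M₀ - ∫ p in Ioo 0 Real.pi ×ˢ univ,
    (ricciRadial I G p.1 p.2 - d) * Real.sin p.1 ^ 2 ∂((volume : Measure ℝ).prod μ) with hD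
  have hle {c e : ℝ} (hc : 0 < c) (he : e < Real.pi) :
      ∫ p in Ioc c e ×ˢ univ, umbilicDefect I G p ∂((volume : Measure ℝ).prod μ) ≤ D :=
    setIntegral_le_of_tendsto hq hnonneg huv hu hv hlim hc he
  have hmem {c e : ℝ} (hc : 0 < c) (he : e < Real.pi) {p : ℝ × N}
      (hp : p ∈ Ioc c e ×ˢ (univ : Set N)) : p.1 ∈ Ioo 0 Real.pi :=
    ⟨hc.trans hp.1.1, hp.1.2.trans_lt he⟩
  have hD0 : 0 ≤ D := ge_of_tendsto hlim (Eventually.of_forall fun n =>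
    setIntegral_nonneg (measurableSet_Ioc.prod MeasurableSet.univ) fun p hp =>
      hnonneg p.1 (hmem (huv n).1 (huv n).2.2 hp) p.2)
  refine ⟨by linarith, ⟨fun h r hr x => ?_, fun h => ?_⟩⟩
  · have hDz : D = 0 := by rw [hD, h, sub_self]
    obtain ⟨c, hc, hcr⟩ := exists_between hr.1
    obtain ⟨e, hre, he⟩ := exists_between hr.2
    have hae : umbilicDefect I G
        =ᵐ[((volume : Measure ℝ).prod μ).restrict (Ioc c e ×ˢ univ)] 0 := by
      refine (setIntegral_eq_zero_iff_of_nonneg_ae ?_ ((hq c e hc he).mono_set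
        (prod_mono Ioc_subset_Icc_self subset_rfl))).1 ?_
      · filter_upwards [ae_restrict_mem (measurableSet_Ioc.prod MeasurableSet.univ)] with p hp
        exact hnonneg p.1 (hmem hc he hp) p.2
      · refine le_antisymm ((hle hc he).trans hDz.le) ?_
        exact setIntegral_nonneg (measurableSet_Ioc.prod MeasurableSet.univ) fun p hp =>
          hnonneg p.1 (hmem hc he hp) p.2
    -- Shrink to an open rectangle around `(r, x)`: there, a continuous function that vanishes
    -- almost everywhere for a measure charging open sets vanishes identically.
    have hae' := ae_restrict_of_ae_restrict_of_subset
      (prod_mono (show Ioo c e ⊆ Ioc c e from Ioo_subset_Ioc_self) (subset_refl (univ : Set N))) hae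
    have heq := Measure.eqOn_open_of_ae_eq hae' (isOpen_Ioo.prod isOpen_univ)
      ((continuousOn_umbilicDefect I hG).mono
        (prod_mono (Ioo_subset_Ioo hc.le he.le) subset_rfl)) continuousOn_const
    exact heq (mk_mem_prod ⟨hcr, hre⟩ (mem_univ x))
  · have hzero (n : ℕ) : ∫ p in Ioc (u n) (v n) ×ˢ univ, umbilicDefect I G p
        ∂((volume : Measure ℝ).prod μ) = 0 :=
      setIntegral_eq_zero_of_forall_eq_zero fun p hp =>
        h p.1 (hmem (huv n).1 (huv n).2.2 hp) p.2
    simp only [hzero] at hlim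
    have := tendsto_nhds_unique hlim tendsto_const_nhds
    linarith

end Rigidity

end RadialMass

end

/-! ### The inequality with both equality statements. -/

theorem corollary5p4 (n : ℕ) (hn : 2 ≤ n)
    {H : Type*} [TopologicalSpace H]
    (I : ModelWithCorners ℝ (EuclideanSpace ℝ (Fin (n - 1))) H)
    {N : Type*} [TopologicalSpace N] [ChartedSpace H N] [IsManifold I ∞ N]
    [CompactSpace N] [T2Space N] [MeasurableSpace N] [BorelSpace N]
    (Ghat : ContMDiffRiemannianMetric I ∞ (EuclideanSpace ℝ (Fin (n - 1)))
      (fun x : N => TangentSpace I x))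
    (G : ℝ → ∀ x : N, TangentSpace I x →L[ℝ] TangentSpace I x →L[ℝ] ℝ)
    (hG : RadialMass.IsSmoothMetricFamily I (Ioo 0 Real.pi) G)
    (M₀ Mπ : ℝ)
    (hM₀ : Tendsto (RadialMass.totalMass I Real.sin Ghat.inner G) (𝓝[>] 0) (𝓝 M₀))
    (hMπ : Tendsto (RadialMass.totalMass I Real.sin Ghat.inner G) (𝓝[<] Real.pi) (𝓝 Mπ))
    (hint : IntegrableOn
      (fun p : ℝ × N => (RadialMass.ricciRadial I G p.1 p.2 - ((n : ℝ) - 1)) * Real.sin p.1 ^ 2)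
      (Ioo 0 Real.pi ×ˢ univ)
      ((volume : Measure ℝ).prod (RadialMass.riemannianVolume I Ghat.inner))) :
    (∫ p in Ioo 0 Real.pi ×ˢ univ,
        (RadialMass.ricciRadial I G p.1 p.2 - ((n : ℝ) - 1)) * Real.sin p.1 ^ 2
        ∂((volume : Measure ℝ).prod (RadialMass.riemannianVolume I Ghat.inner))) ≤ Mπ - M₀ ∧
    (Mπ - M₀ = (∫ p in Ioo 0 Real.pi ×ˢ univ,
        (RadialMass.ricciRadial I G p.1 p.2 - ((n : ℝ) - 1)) * Real.sin p.1 ^ 2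
        ∂((volume : Measure ℝ).prod (RadialMass.riemannianVolume I Ghat.inner))) ↔
      ∃ Gtilde : ContMDiffRiemannianMetric I ∞ (EuclideanSpace ℝ (Fin (n - 1)))
          (fun x : N => TangentSpace I x),
        ∀ r ∈ Ioo 0 Real.pi, ∀ x : N, G r x = Real.sin r ^ 2 • Gtilde.inner x) ∧
    (∀ r₀ ∈ Icc 0 Real.pi,
      RadialMass.IsAsymptoticAt I (Ioo 0 Real.pi) G
        (RadialMass.warped I Real.sin Ghat.inner) r₀ →
      (Mπ - M₀ = (∫ p in Ioo 0 Real.pi ×ˢ univ,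
          (RadialMass.ricciRadial I G p.1 p.2 - ((n : ℝ) - 1)) * Real.sin p.1 ^ 2
          ∂((volume : Measure ℝ).prod (RadialMass.riemannianVolume I Ghat.inner))) ↔
        ∀ r ∈ Ioo 0 Real.pi, ∀ x : N,
          G r x = RadialMass.warped I Real.sin Ghat.inner r x)) := by
  -- The constant is the dimension `d = n - 1` of `N`; the truncated subtraction is harmless for `n
  -- ≥ 2`.
  have hd : (n : ℝ) - 1 = ((n - 1 : ℕ) : ℝ) := by
    rw [Nat.cast_sub (by omega), Nat.cast_one]
  rw [hd] at hint ⊢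
  obtain ⟨hle, hiff⟩ := RadialMass.integral_le_totalMass_sub I Ghat hG hM₀ hMπ hint
  have hcone : (∀ r ∈ Ioo 0 Real.pi, ∀ x, RadialMass.umbilicDefect I G (r, x) = 0) ↔
      ∃ Gtilde : ContMDiffRiemannianMetric I ∞ (EuclideanSpace ℝ (Fin (n - 1)))
          (fun x : N => TangentSpace I x),
        ∀ r ∈ Ioo 0 Real.pi, ∀ x : N, G r x = Real.sin r ^ 2 • Gtilde.inner x := by
    constructor
    · intro h
      have hmid : Real.pi / 2 ∈ Ioo 0 Real.pi :=
        ⟨by positivity, by linarith [Real.pi_pos]⟩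
      exact ⟨hG.metricAt I hmid, fun r hr x =>
        RadialMass.eq_sin_sq_smul_of_umbilicDefect_eq_zero I hG (fun t ht => h t ht x) hr⟩
    · rintro ⟨Gtilde, h⟩ r hr x
      exact RadialMass.umbilicDefect_eq_zero_of_warped I hG hr fun t ht => h t ht x
  rw [hiff, hcone]
  refine ⟨hle, Iff.rfl, fun r₀ hr₀ hasym => ⟨?_, fun h => ⟨Ghat, h⟩⟩⟩
  rintro ⟨Gtilde, h⟩ r hr x
  -- The poles `0` and `π` are limits of interior radii, so they need no separate treatment.
  rw [← closure_Ioo Real.pi_pos.ne] at hr₀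
  rw [h r hr x, RadialMass.eq_of_isAsymptoticAt I
    (fun t ht => RadialMass.sin_ne_zero_of_mem (r := t) ht) h hr₀ hasym x]
  rfl
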